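/- A finite partial monitoring game with action set $A$, outcome set $Z$ (both finite) and signal set $\Sigma$ consists of a loss function $\mathcal L:A\times Z\to\mathbb R$ and a signal function $\mathcal S:A\times Z\to\Sigma$. Write $\Delta(A),\Delta(Z)$ for the sets of probability distributions on $A$ and $Z$. For $\pi\in\Delta(A)$, $x\in\Delta(Z)$ let $\mathcal L(\pi,x)=\sum_{a}\sum_{z}\pi(a)x(z)\mathcal L(a,z)$. Write $x\mathrel{\mathrm R}y$ if for every action $a$ the law of $\mathcal S(a,z)$ is the same for $z\sim x$ and for $z\sim y$, and put $$\mathcal V(\pi,x)=\sup_{y\in\Delta(Z):\,y\mathrel{\mathrm R}x}\mathcal L(\pi,y),\qquad \mathcal V_\star(x)=\min_{\pi\in\Delta(A)}\mathcal V(\pi,x).$$ An adversary secretly fixes $x_1,\dots,x_n\in\Delta(Z)$, and outcomes $z_t\sim x_t$ are drawn independently. In round $t$ the learner $\mathscr L$ samples $a_t$ from a distribution $\pi_t\in\Delta(A)$ that depends only on $a_1,\sigma_1,\dots,a_{t-1},\sigma_{t-1}$, and then observes $\sigma_t=\mathcal S(a_t,z_t)$. The Rustichini regret and the minimax Rustichini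 regret are $$\mathfrak R_n(\mathscr L,(x_t)_{t=1}^n)=\mathbb E\Big[\sum_{t=1}^n\mathcal V(\pi_t,x_t)\Big]-n\,\mathcal V_\star\Big(\frac1n\sum_{t=1}^n x_t\Big),\qquad \mathfrak R_n^\star=\inf_{\mathscr L}\sup_{(x_t)_{t=1}^n}\mathfrak R_n(\mathscr L,(x_t)_{t=1}^n).$$ Theorem. Let $A=\{1,\dots,9\}$, $Z=\{1,\dots,8\}$, $\Sigma=\{0,1\}$, let $c>0$, and let $\mathcal L=c\,\mathcal L_0$, where (rows are actions, columns are outcomes) $$\mathcal L_0=\begin{bmatrix} 1&0&0&0&1&1&0&0\\ 1&0&0&0&1&0&0&1\\ 1&1&0&0&1&0&0&0\\ 1&0&0&1&1&0&0&0\\ 1&\frac14&0&\frac14&1&\frac14&0&\frac14\\ 1&\frac14&0&\frac14&1&\frac14&0&\frac14\\ 1&\frac14&0&\frac14&1&\frac14&0&\frac14\\ 2&2&2&2&2&2&2&2\\ 2&2&2&2&2&2&2&2 \end{bmatrix},\qquad \mathcal S=\begin{bmatrix} 0&0&0&0&0&0&0&0\\ 0&0&0&0&0&0&0&0\\ 0&0&0&0&0&0&0&0\\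 0&0&0&0&0&0&0&0\\ 1&1&0&0&0&0&0&0\\ 0&1&1&0&0&0&0&0\\ 1&1&1&1&0&0&0&0\\ 0&0&0&0&1&1&0&0\\ 0&0&0&0&0&1&1&0 \end{bmatrix}$$ (for $c=\frac12$ all losses lie in $[0,1]$). Then $\mathfrak R_n^\star>0$ for all sufficiently large $n$, and $$\limsup_{n\to\infty}\frac{\log \mathfrak R_n^\star}{\log n}=\frac47 .$$ In particular $\mathfrak R_n^\star$ is neither eventually $0$, nor $\Theta(n^{1/2})$, nor $\Theta(n^{2/3})$. The same statements hold when $\mathcal V(\pi_t,x_t)$ is replaced in the definition of the regret by $\mathcal V(a_t,x_t)$, that is, by $\mathcal V(\cdot,x_t)$ evaluated at the point mass on the sampled action $a_t$. -/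

import Mathlib

namespace PartialMonitoring

noncomputable section

/-- A partial monitoring game with action set `A`, latent (outcome) space `Z`, signal set `S`:
a real-valued loss function and a signal function. -/
structure Game (A Z S : Type) where
  loss : A → Z → ℝ
  signal : A → Z → S

/-- A (randomised) learner: after the history `(a_1, σ_1), …, (a_t, σ_t)` of the first `t` rounds,
it prescribes the distribution of the next action. -/
abbrev Learner (A S : Type) [Fintype A] : Type :=
  (t : ℕ) → (Fin t → A × S) → stdSimplex ℝ A

variable {A Z S : Type} [Fintype A] [DecidableEq A] [Fintype Z] [DecidableEq S]

namespace Game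

/-- `𝓛(π, x) = ∑_a π(a) ∑_z x(z) 𝓛(a, z)`. -/
def expectedLoss (G : Game A Z S) (π : A → ℝ) (x : Z → ℝ) : ℝ :=
  ∑ a, π a * ∑ z, x z * G.loss a z

/-- The law of the signal `𝓢(a, z)` when `z ∼ x`: the probability of each signal `s`. -/
def signalLaw (G : Game A Z S) (a : A) (x : Z → ℝ) (s : S) : ℝ :=
  ∑ z, if G.signal a z = s then x z else 0

/-- The relation `x R y`: every action has the same signal distribution under `x` and `y`. -/
def Indistinguishable (G : Game A Z S) (x y : Z → ℝ) : Prop :=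
  ∀ a : A, G.signalLaw a x = G.signalLaw a y

/-- `𝓥(π, x) = sup { 𝓛(π, y) : y a distribution on Z, y R x }`, a supremum over a set that is
nonempty and bounded whenever `x` is a distribution. -/
def value (G : Game A Z S) (π : A → ℝ) (x : Z → ℝ) : ℝ :=
  sSup {r : ℝ | ∃ y ∈ stdSimplex ℝ Z, G.Indistinguishable y x ∧ r = G.expectedLoss π y}

/-- `𝓥⋆(x) = min_π 𝓥(π, x)`, over all distributions `π` on the actions. -/
def optValue (G : Game A Z S) (x : Z → ℝ) : ℝ :=
  sInf {r : ℝ | ∃ π ∈ stdSimplex ℝ A, r = G.value π x}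

/-- What the learner has observed before round `t` (rounds are numbered from `0`), when the actions
are `a` and the outcomes are `z`. -/
def history (G : Game A Z S) {n : ℕ} (a : Fin n → A) (z : Fin n → Z) (t : Fin n) :
    Fin (t : ℕ) → A × S :=
  fun s => (a (Fin.castLE t.isLt.le s), G.signal (a (Fin.castLE t.isLt.le s))
    (z (Fin.castLE t.isLt.le s)))

/-- The distribution `π_t` of the action of round `t` given the history before round `t`. -/
def policyAt (G : Game A Z S) {n : ℕ} (ℓ : Learner A S) (a : Fin n → A) (z : Fin n → Z)
    (t : Fin n) : A → ℝ :=
  (ℓ t (G.history a z t) : A → ℝ)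

/-- The probability that the actions are `a` and the outcomes are `z`, when the learner `ℓ` plays
and the outcomes are independent with `z_t ∼ x_t`. -/
def pathProb (G : Game A Z S) {n : ℕ} (ℓ : Learner A S) (x : Fin n → stdSimplex ℝ Z)
    (a : Fin n → A) (z : Fin n → Z) : ℝ :=
  ∏ t, (G.policyAt ℓ a z t (a t) * (x t : Z → ℝ) (z t))

/-- The average `(1/n) ∑_t x_t` of the adversary's distributions. -/
def average {n : ℕ} (x : Fin n → stdSimplex ℝ Z) : Z → ℝ :=
  fun z => (1 / (n : ℝ)) * ∑ t, (x t : Z → ℝ) z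

/-- The Rustichini regret `𝔼[∑_t 𝓥(π_t, x_t)] - n 𝓥⋆((1/n) ∑_t x_t)`. -/
def regret (G : Game A Z S) {n : ℕ} (ℓ : Learner A S) (x : Fin n → stdSimplex ℝ Z) : ℝ :=
  (∑ a : Fin n → A, ∑ z : Fin n → Z,
      G.pathProb ℓ x a z * ∑ t, G.value (G.policyAt ℓ a z t) (x t : Z → ℝ))
    - n * G.optValue (average x)

/-- The variant `𝔼[∑_t 𝓥(a_t, x_t)] - n 𝓥⋆((1/n) ∑_t x_t)` of the Rustichini regret, evaluated at
the sampled actions `a_t` in place of the distributions `π_t` from which they are sampled. -/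
def sampledRegret (G : Game A Z S) {n : ℕ} (ℓ : Learner A S) (x : Fin n → stdSimplex ℝ Z) : ℝ :=
  (∑ a : Fin n → A, ∑ z : Fin n → Z,
      G.pathProb ℓ x a z * ∑ t, G.value (Pi.single (a t) 1) (x t : Z → ℝ))
    - n * G.optValue (average x)

/-- The minimax regret over `n` rounds, `inf_ℓ sup_{(x_t)} regret`. All regrets are bounded by a
constant that depends only on `n` and the loss function. -/
def minimaxRegret (G : Game A Z S) (n : ℕ) : ℝ :=
  ⨅ ℓ : Learner A S, ⨆ x : Fin n → stdSimplex ℝ Z, G.regret ℓ x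

/-- The minimax value over `n` rounds of the variant `sampledRegret`. -/
def minimaxSampledRegret (G : Game A Z S) (n : ℕ) : ℝ :=
  ⨅ ℓ : Learner A S, ⨆ x : Fin n → stdSimplex ℝ Z, G.sampledRegret ℓ x

end Game

/-- The loss matrix (rows: actions, columns: outcomes), with entries in `[0, 2]`. -/
def exoticLoss : Matrix (Fin 9) (Fin 8) ℝ :=
  !![1, 0, 0, 0, 1, 1, 0, 0;
     1, 0, 0, 0, 1, 0, 0, 1;
     1, 1, 0, 0, 1, 0, 0, 0;
     1, 0, 0, 1, 1, 0, 0, 0;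
     1, 1/4, 0, 1/4, 1, 1/4, 0, 1/4;
     1, 1/4, 0, 1/4, 1, 1/4, 0, 1/4;
     1, 1/4, 0, 1/4, 1, 1/4, 0, 1/4;
     2, 2, 2, 2, 2, 2, 2, 2;
     2, 2, 2, 2, 2, 2, 2, 2]

/-- The signal matrix (rows: actions, columns: outcomes). -/
def exoticSignal : Matrix (Fin 9) (Fin 8) (Fin 2) :=
  !![0, 0, 0, 0, 0, 0, 0, 0;
     0, 0, 0, 0, 0, 0, 0, 0;
     0, 0, 0, 0, 0, 0, 0, 0;
     0, 0, 0, 0, 0, 0, 0, 0;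
     1, 1, 0, 0, 0, 0, 0, 0;
     0, 1, 1, 0, 0, 0, 0, 0;
     1, 1, 1, 1, 0, 0, 0, 0;
     0, 0, 0, 0, 1, 1, 0, 0;
     0, 0, 0, 0, 0, 1, 1, 0]

/-- The game with 9 actions and 8 outcomes whose loss matrix is `c` times `exoticLoss`. -/
def exoticGame (c : ℝ) : Game (Fin 9) (Fin 8) (Fin 2) where
  loss a z := c * exoticLoss a z
  signal a z := exoticSignal a z

/-- `limsup_{n → ∞} log (R n) / log n`, in the extended reals. -/
def growthExponent (R : ℕ → ℝ) : EReal :=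
  Filter.limsup (fun n : ℕ => ((Real.log (R n) / Real.log n : ℝ) : EReal)) Filter.atTop

/-- `R` is eventually positive and `limsup log (R n) / log n = 4/7`; in particular `R` is not
eventually zero, and it is neither `Θ(n^{1/2})` nor `Θ(n^{2/3})`. -/
structure HasExoticRate (R : ℕ → ℝ) : Prop where
  eventually_pos : ∀ᶠ n in Filter.atTop, 0 < R n
  exponent : growthExponent R = ((4 / 7 : ℝ) : EReal)
  not_half : ¬ Asymptotics.IsTheta Filter.atTop R (fun n : ℕ => (n : ℝ) ^ (1 / 2 : ℝ))
  not_two_thirds : ¬ Asymptotics.IsTheta Filter.atTop R (fun n : ℕ => (n : ℝ) ^ (2 / 3 : ℝ))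

end

end PartialMonitoring

/-!
Arrange the outcomes as two squares, `0, 1, 2, 3` and `4, 5, 6, 7`. The signals reveal about a
distribution `x` the mass of each square and of its sides; what stays hidden is how the mass of a
square is split between its two diagonals. All losses grow with the mass of the even corners, so one
distribution (`worst x`) is the worst among those indistinguishable from `x` for every action at
once. Hence `𝓥(π, x)` is linear in `π` (`value_exotic`), the two notions of regret coincide
(`sampledRegret_eq_regret`), and with `d = x₁ - x₃` and `d' = x₅ - x₇` the regret is, up to the
factor `c / 2`, the expected sum of the losses `gap` plus `|∑ d| + |∑ d'|` (`regret_exotic`). The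
losses of the nine actions are `±d' - |d|` (two), `±d - |d'|` (two), `-(|d| + |d'|) / 2` (three) and
constants between `2` and `4` (two). The sign of `∑ d`, or else the sign of `∑ d'`, has to be found
out; learning about `d` costs `(|d| + |d'|) / 2` per observation, learning about `d'` costs a
constant. In what follows `n = ρ⁻⁷`, so that the claim is that the regret is `ρ⁻⁴` up to a
logarithm.

*Lower bound.* Compare the constant adversaries with `(d, d') = ±(ρ³ / 4, ρ² / 4)`. Every action is
bad in at least one of them, at a cost of order `ρ³` or more. The affinity `∑ √(P Q)` of the two
laws of the observations decreases by order `ρ⁶` for each observation that concerns `d` and by order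
`ρ⁴` for each that concerns `d'`, while these cost at least order `ρ²` and `1`: per unit of regret
the affinity decreases by order `ρ⁴` (`one_sub_excess_le_affinity`). So a regret much smaller than
`ρ⁻⁴` leaves the laws close, and then the regret is of order `n ρ³ = ρ⁻⁴` (`sum_meanExcess_ge`).

*Upper bound.* The learner observes everything at rate `δ ≈ ρ³`, which costs `n δ ≈ ρ⁻⁴` and yields
an estimate `v` of `∑ d'` with an error of order `√(n / δ) = ρ⁻⁵`. Where `|v|` exceeds
`2 K ≈ ρ⁻⁵ log n`, the sign of `∑ d'` is known and is used; where `|v| ≤ K`, the learner plays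
exponential weights on the sign of `∑ d`, with learning rate `η ≈ ρ⁴`. There it explores the first
square at the rate `γ (1 - g²)`, `γ = ρ`, where `g` is the slope of the potential
`log (cosh (η u)) / η`. This rate suffices where the potential is curved
(`Tuning.roundMean_coshPotential_le`), and as it vanishes where `g` is near `±1`, the mean sign can
be raised so that the exploration of the first square costs nothing on that square (`Tuning.bias`).
On the second square it costs `γ / 2` times the growth of `|∑ d'|` while `|v|` is of order `K` at
most, that is `γ K ≈ ρ⁻⁴ log n` (`Tuning.abs_sum_devR_le`). The interpolation between the two regimes
is smooth (`ramp`), so that its fluctuations contribute only `γ n / (δ K)`.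
-/

namespace PartialMonitoring

open Finset

/-! ### Sums over finite histories -/

section Weights

variable {O : Type} [Fintype O]

/-- The weight that a family of (not necessarily stochastic) kernels gives to a finite history. -/
def weight (k : (t : ℕ) → (Fin t → O) → O → ℝ) : (t : ℕ) → (Fin t → O) → ℝ
  | 0, _ => 1
  | t + 1, h => weight k t (Fin.init h) * k t (Fin.init h) (h (Fin.last t))

/-- The integral of `F` over the histories of length `t`, with respect to `weight k t`. -/
def expect (k : (t : ℕ) → (Fin t → O) → O → ℝ) (t : ℕ) (F : (Fin t → O) → ℝ) : ℝ :=
  ∑ h, weight k t h * F h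

lemma sum_snoc {B : Type} [Fintype B] (n : ℕ) (F : (Fin (n + 1) → B) → ℝ) :
    ∑ h, F h = ∑ h : Fin n → B, ∑ o, F (Fin.snoc (α := fun _ => B) h o) := by
  rw [← Fintype.sum_equiv (Fin.snocEquiv (fun _ => B)) _ F (fun _ => rfl), Fintype.sum_prod_type,
    Finset.sum_comm]
  rfl

omit [Fintype O] in
lemma weight_snoc (k : (t : ℕ) → (Fin t → O) → O → ℝ) (t : ℕ) (h : Fin t → O) (o : O) :
    weight k (t + 1) (Fin.snoc (α := fun _ => O) h o) = weight k t h * k t h o := by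
  simp [weight]

lemma expect_zero (k : (t : ℕ) → (Fin t → O) → O → ℝ) (F : (Fin 0 → O) → ℝ) :
    expect k 0 F = F Fin.elim0 := by
  simp only [expect, weight, one_mul]
  rw [Fintype.sum_unique]
  congr 1

/-- The tower property. -/
lemma expect_succ (k : (t : ℕ) → (Fin t → O) → O → ℝ) (t : ℕ) (F : (Fin (t + 1) → O) → ℝ) :
    expect k (t + 1) F
      = expect k t (fun h => ∑ o, k t h o * F (Fin.snoc (α := fun _ => O) h o)) := by
  simp only [expect]
  rw [sum_snoc]
  refine Finset.sum_congr rfl fun h _ => ?_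
  rw [Finset.mul_sum]
  refine Finset.sum_congr rfl fun o _ => ?_
  rw [weight_snoc, mul_assoc]

omit [Fintype O] in
lemma weight_nonneg {k : (t : ℕ) → (Fin t → O) → O → ℝ} (hk : ∀ t h o, 0 ≤ k t h o) :
    ∀ t h, 0 ≤ weight k t h
  | 0, _ => zero_le_one
  | t + 1, _ => mul_nonneg (weight_nonneg hk t _) (hk _ _ _)

lemma expect_mono {k : (t : ℕ) → (Fin t → O) → O → ℝ} (hk : ∀ t h o, 0 ≤ k t h o) {t : ℕ}
    {F F' : (Fin t → O) → ℝ} (hF : ∀ h, F h ≤ F' h) : expect k t F ≤ expect k t F' :=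
  Finset.sum_le_sum fun h _ => mul_le_mul_of_nonneg_left (hF h) (weight_nonneg hk t h)

lemma expect_nonneg {k : (t : ℕ) → (Fin t → O) → O → ℝ} (hk : ∀ t h o, 0 ≤ k t h o) {t : ℕ}
    {F : (Fin t → O) → ℝ} (hF : ∀ h, 0 ≤ F h) : 0 ≤ expect k t F :=
  Finset.sum_nonneg fun h _ => mul_nonneg (weight_nonneg hk t h) (hF h)

lemma expect_add (k : (t : ℕ) → (Fin t → O) → O → ℝ) {t : ℕ} (F F' : (Fin t → O) → ℝ) :
    expect k t (fun h => F h + F' h) = expect k t F + expect k t F' := by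
  simp [expect, mul_add, Finset.sum_add_distrib]

lemma expect_sub (k : (t : ℕ) → (Fin t → O) → O → ℝ) {t : ℕ} (F F' : (Fin t → O) → ℝ) :
    expect k t (fun h => F h - F' h) = expect k t F - expect k t F' := by
  simp [expect, mul_sub, Finset.sum_sub_distrib]

lemma expect_const_mul (k : (t : ℕ) → (Fin t → O) → O → ℝ) {t : ℕ} (c : ℝ)
    (F : (Fin t → O) → ℝ) : expect k t (fun h => c * F h) = c * expect k t F := by
  simp only [expect, Finset.mul_sum]
  exact Finset.sum_congr rfl fun h _ => by ring

lemma expect_one {k : (t : ℕ) → (Fin t → O) → O → ℝ} (hk : ∀ t h, ∑ o, k t h o = 1) (t : ℕ) :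
    expect k t (fun _ => 1) = 1 := by
  induction t with
  | zero => rw [expect_zero]
  | succ t ih => rw [expect_succ]; simpa [hk] using ih

lemma expect_const {k : (t : ℕ) → (Fin t → O) → O → ℝ} (hk : ∀ t h, ∑ o, k t h o = 1) (t : ℕ)
    (c : ℝ) : expect k t (fun _ => c) = c := by
  have := expect_const_mul k (t := t) c (fun _ => 1)
  simpa [expect_one hk] using this

lemma abs_expect_le {k : (t : ℕ) → (Fin t → O) → O → ℝ} (hk : ∀ t h o, 0 ≤ k t h o) {t : ℕ}
    (F : (Fin t → O) → ℝ) : |expect k t F| ≤ expect k t (fun h => |F h|) := by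
  refine (Finset.abs_sum_le_sum_abs _ _).trans (Finset.sum_le_sum fun h _ => ?_)
  rw [abs_mul, abs_of_nonneg (weight_nonneg hk t h)]

end Weights

/-! ### The law of the observations in a game -/

section Law

variable {A Z S : Type} [Fintype A] [Fintype Z] [DecidableEq S]

namespace Game

/-- The conditional law of the next action and signal, given the past, when the outcomes are
drawn from `x 0, x 1, …`. -/
noncomputable def obsKernel (G : Game A Z S) (ℓ : Learner A S) (x : ℕ → stdSimplex ℝ Z) (t : ℕ)
    (h : Fin t → A × S) (o : A × S) : ℝ :=
  (ℓ t h : A → ℝ) o.1 * G.signalLaw o.1 (x t) o.2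

omit [Fintype A] in
lemma signalLaw_nonneg (G : Game A Z S) {x : Z → ℝ} (hx : x ∈ stdSimplex ℝ Z) (a : A) (s : S) :
    0 ≤ G.signalLaw a x s :=
  Finset.sum_nonneg fun z _ => by split_ifs; exacts [hx.1 z, le_rfl]

lemma obsKernel_nonneg (G : Game A Z S) (ℓ : Learner A S) (x : ℕ → stdSimplex ℝ Z) (t : ℕ)
    (h : Fin t → A × S) (o : A × S) : 0 ≤ G.obsKernel ℓ x t h o :=
  mul_nonneg ((ℓ t h).2.1 _) (G.signalLaw_nonneg (x t).2 _ _)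

variable [Fintype S]

omit [Fintype A] in
lemma sum_signalLaw_mul (G : Game A Z S) (a : A) (x : Z → ℝ) (F : S → ℝ) :
    ∑ s, G.signalLaw a x s * F s = ∑ z, x z * F (G.signal a z) := by
  simp only [signalLaw, Finset.sum_mul]
  rw [Finset.sum_comm]
  refine Finset.sum_congr rfl fun z _ => ?_
  simp [ite_mul]

lemma sum_obsKernel_mul (G : Game A Z S) (ℓ : Learner A S) (x : ℕ → stdSimplex ℝ Z) (t : ℕ)
    (h : Fin t → A × S) (F : A × S → ℝ) :
    ∑ o, G.obsKernel ℓ x t h o * F o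
      = ∑ a, (ℓ t h : A → ℝ) a * ∑ z, (x t : Z → ℝ) z * F (a, G.signal a z) := by
  rw [Fintype.sum_prod_type]
  refine Finset.sum_congr rfl fun a _ => ?_
  rw [← G.sum_signalLaw_mul a (x t) (fun s => F (a, s)), Finset.mul_sum]
  exact Finset.sum_congr rfl fun s _ => by rw [obsKernel]; ring

lemma sum_obsKernel (G : Game A Z S) (ℓ : Learner A S) (x : ℕ → stdSimplex ℝ Z) (t : ℕ)
    (h : Fin t → A × S) : ∑ o, G.obsKernel ℓ x t h o = 1 := by
  have := G.sum_obsKernel_mul ℓ x t h (fun _ => 1)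
  simpa [(x t).2.2, (ℓ t h).2.2] using this

omit [Fintype A] [Fintype Z] [DecidableEq S] [Fintype S] in
lemma history_snoc (G : Game A Z S) {n : ℕ} (a : Fin n → A) (z : Fin n → Z) (a₀ : A) (z₀ : Z)
    (t : Fin n) :
    G.history (Fin.snoc (α := fun _ => A) a a₀) (Fin.snoc (α := fun _ => Z) z z₀) t.castSucc
      = G.history a z t := by
  funext s
  have h : (Fin.castLE t.castSucc.isLt.le s : Fin (n + 1))
      = Fin.castSucc (Fin.castLE t.isLt.le s) := rfl
  simp only [history]
  erw [h, Fin.snoc_castSucc, Fin.snoc_castSucc]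

omit [Fintype A] [Fintype Z] [DecidableEq S] [Fintype S] in
lemma history_snoc_last (G : Game A Z S) {n : ℕ} (a : Fin n → A) (z : Fin n → Z) (a₀ : A)
    (z₀ : Z) :
    G.history (Fin.snoc (α := fun _ => A) a a₀) (Fin.snoc (α := fun _ => Z) z z₀) (Fin.last n)
      = fun s => (a s, G.signal (a s) (z s)) := by
  funext s
  have h : (Fin.castLE (Fin.last n).isLt.le s : Fin (n + 1)) = Fin.castSucc s := rfl
  simp only [history]
  erw [h, Fin.snoc_castSucc, Fin.snoc_castSucc]

omit [DecidableEq S] [Fintype S] in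
lemma pathProb_snoc (G : Game A Z S) (ℓ : Learner A S) (x : ℕ → stdSimplex ℝ Z) {n : ℕ}
    (a : Fin n → A) (z : Fin n → Z) (a₀ : A) (z₀ : Z) :
    G.pathProb ℓ (fun i : Fin (n + 1) => x i) (Fin.snoc (α := fun _ => A) a a₀)
        (Fin.snoc (α := fun _ => Z) z z₀)
      = G.pathProb ℓ (fun i : Fin n => x i) a z
        * ((ℓ n (fun s => (a s, G.signal (a s) (z s))) : A → ℝ) a₀ * (x n : Z → ℝ) z₀) := by
  simp only [pathProb]
  rw [Fin.prod_univ_castSucc]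
  congr 1
  · refine Finset.prod_congr rfl fun t _ => ?_
    simp only [policyAt, Fin.snoc_castSucc]
    rw [history_snoc]
    rfl
  · simp only [policyAt, Fin.snoc_last]
    rw [history_snoc_last]
    rfl

omit [DecidableEq S] [Fintype S] in
lemma sum_pathProb_succ (G : Game A Z S) (ℓ : Learner A S) (x : ℕ → stdSimplex ℝ Z) {n : ℕ}
    (Ψ : (Fin (n + 1) → A) → (Fin (n + 1) → Z) → ℝ) :
    ∑ a, ∑ z, G.pathProb ℓ (fun i : Fin (n + 1) => x i) a z * Ψ a z
      = ∑ a, ∑ z, G.pathProb ℓ (fun i : Fin n => x i) a z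
          * ∑ a₀, (ℓ n (fun s => (a s, G.signal (a s) (z s))) : A → ℝ) a₀
            * ∑ z₀, (x n : Z → ℝ) z₀ * Ψ (Fin.snoc (α := fun _ => A) a a₀)
                (Fin.snoc (α := fun _ => Z) z z₀) := by
  rw [sum_snoc]
  refine Finset.sum_congr rfl fun a _ => ?_
  simp_rw [sum_snoc (B := Z)]
  rw [Finset.sum_comm]
  refine Finset.sum_congr rfl fun z _ => ?_
  rw [Finset.mul_sum]
  refine Finset.sum_congr rfl fun a₀ _ => ?_
  rw [Finset.mul_sum, Finset.mul_sum]
  refine Finset.sum_congr rfl fun z₀ _ => ?_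
  rw [pathProb_snoc]
  ring

/-- The observations of `n` rounds have the law `weight (G.obsKernel ℓ x) n`. -/
lemma sum_pathProb_history (G : Game A Z S) (ℓ : Learner A S) (x : ℕ → stdSimplex ℝ Z) (n : ℕ)
    (F : (Fin n → A × S) → ℝ) :
    ∑ a, ∑ z, G.pathProb ℓ (fun i : Fin n => x i) a z * F (fun s => (a s, G.signal (a s) (z s)))
      = expect (G.obsKernel ℓ x) n F := by
  induction n with
  | zero =>
    rw [expect_zero]
    simp only [Fintype.sum_unique, pathProb, Finset.univ_eq_empty, Finset.prod_empty, one_mul]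
    congr 1
    exact Subsingleton.elim _ _
  | succ n ih =>
    rw [sum_pathProb_succ, expect_succ, ← ih]
    refine Finset.sum_congr rfl fun a _ => Finset.sum_congr rfl fun z _ => ?_
    rw [sum_obsKernel_mul]
    congr 1
    refine Finset.sum_congr rfl fun a₀ _ => ?_
    congr 1
    refine Finset.sum_congr rfl fun z₀ _ => ?_
    congr 2
    funext s
    refine Fin.lastCases ?_ (fun s => ?_) s <;> simp

/-- An expected sum of per-round costs, as a sum of integrals over histories. -/
lemma sum_pathProb_mul_sum (G : Game A Z S) (ℓ : Learner A S) (x : ℕ → stdSimplex ℝ Z)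
    (f : (t : ℕ) → (Fin t → A × S) → A → ℝ) (n : ℕ) :
    ∑ a, ∑ z, G.pathProb ℓ (fun i : Fin n => x i) a z
        * ∑ t : Fin n, f t (G.history a z t) (a t)
      = ∑ t ∈ range n, expect (G.obsKernel ℓ x) t
          (fun h => ∑ a, (ℓ t h : A → ℝ) a * f t h a) := by
  induction n with
  | zero => simp
  | succ n ih =>
    rw [Finset.sum_range_succ, ← ih, ← sum_pathProb_history, sum_pathProb_succ,
      ← Finset.sum_add_distrib]
    refine Finset.sum_congr rfl fun a _ => ?_
    rw [← Finset.sum_add_distrib]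
    refine Finset.sum_congr rfl fun z _ => ?_
    rw [← mul_add]
    have hx : ∑ i, (x n : Z → ℝ) i = 1 := (x n).2.2
    have hl : ∑ i, (ℓ n (fun s => (a s, G.signal (a s) (z s))) : A → ℝ) i = 1 := (ℓ n _).2.2
    congr 1
    simp_rw [Fin.sum_univ_castSucc]
    simp only [Fin.snoc_castSucc, history_snoc, Fin.snoc_last, history_snoc_last]
    simp only [Fin.val_castSucc, Fin.val_last, mul_add, Finset.sum_add_distrib]
    simp only [← Finset.sum_mul, hx, hl, one_mul]

end Game

end Law

/-! ### The value functions of the game -/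

lemma coe_mem_stdSimplex {ι : Type} [Fintype ι] (p : stdSimplex ℝ ι) :
    (p : ι → ℝ) ∈ stdSimplex ℝ ι := p.2

lemma sum_coe_stdSimplex {ι : Type} [Fintype ι] (p : stdSimplex ℝ ι) :
    ∑ i, (p : ι → ℝ) i = 1 := p.2.2

/-- The imbalance `x₁ - x₃` of the first square of outcomes. -/
def devL (x : Fin 8 → ℝ) : ℝ := x 1 - x 3

/-- The imbalance `x₅ - x₇` of the second square of outcomes. -/
def devR (x : Fin 8 → ℝ) : ℝ := x 5 - x 7

/-- The linear part of the value functions. -/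
noncomputable def mid (x : Fin 8 → ℝ) : ℝ := x 0 + (x 1 + x 3) / 2 + x 4 + (x 5 + x 7) / 2

/-- Twice the excess over `mid x` of the value of each action, for `c = 1`. -/
noncomputable def gap (a : Fin 9) (x : Fin 8 → ℝ) : ℝ :=
  ![devR x - |devL x|, -devR x - |devL x|, devL x - |devR x|, -devL x - |devR x|,
    -(|devL x| + |devR x|) / 2, -(|devL x| + |devR x|) / 2, -(|devL x| + |devR x|) / 2,
    2 * (2 - mid x), 2 * (2 - mid x)] a

/-- The distribution indistinguishable from `x` that is worst for every action at once: inside each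
square as much mass as possible is moved to the two even corners. -/
noncomputable def worst (x : Fin 8 → ℝ) : Fin 8 → ℝ :=
  ![x 0 + min (x 1) (x 3), x 1 - min (x 1) (x 3), x 2 + min (x 1) (x 3), x 3 - min (x 1) (x 3),
    x 4 + min (x 5) (x 7), x 5 - min (x 5) (x 7), x 6 + min (x 5) (x 7), x 7 - min (x 5) (x 7)]

lemma min_eq_half (a b : ℝ) : min a b = (a + b - |a - b|) / 2 := by
  rcases le_total a b with h | h
  · rw [min_eq_left h, abs_of_nonpos (by linarith)]; ring
  · rw [min_eq_right h, abs_of_nonneg (by linarith)]; ring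

lemma sum_worst_loss (x : Fin 8 → ℝ) (hx : ∑ z, x z = 1) (a : Fin 9) :
    ∑ z, worst x z * exoticLoss a z = mid x + gap a x / 2 := by
  simp only [Fin.sum_univ_eight] at hx
  fin_cases a <;>
    simp [Fin.sum_univ_eight, worst, exoticLoss, mid, gap, devL, devR, min_eq_half] <;>
    linarith

lemma worst_mem {x : Fin 8 → ℝ} (hx : x ∈ stdSimplex ℝ (Fin 8)) :
    worst x ∈ stdSimplex ℝ (Fin 8) := by
  obtain ⟨h0, h1⟩ := hx
  refine ⟨fun z => ?_, ?_⟩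
  · have a1 := le_min (h0 1) (h0 3)
    have a2 := le_min (h0 5) (h0 7)
    have b1 := min_le_left (x 1) (x 3)
    have b2 := min_le_right (x 1) (x 3)
    have b3 := min_le_left (x 5) (x 7)
    have b4 := min_le_right (x 5) (x 7)
    have c0 := h0 0
    have c2 := h0 2
    have c4 := h0 4
    have c6 := h0 6
    fin_cases z <;> simp [worst] <;> linarith
  · simp only [Fin.sum_univ_eight] at h1 ⊢
    simp [worst]
    linarith

lemma signalLaw_one (c : ℝ) (x : Fin 8 → ℝ) (a : Fin 9) :
    (exoticGame c).signalLaw a x 1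
      = ![0, 0, 0, 0, x 0 + x 1, x 1 + x 2, x 0 + x 1 + x 2 + x 3, x 4 + x 5, x 5 + x 6] a := by
  fin_cases a <;> simp [Game.signalLaw, exoticGame, exoticSignal, Fin.sum_univ_eight]

lemma signalLaw_zero (c : ℝ) (x : Fin 8 → ℝ) (a : Fin 9) :
    (exoticGame c).signalLaw a x 0 = ∑ z, x z - (exoticGame c).signalLaw a x 1 := by
  rw [Game.signalLaw, Game.signalLaw, ← Finset.sum_sub_distrib]
  refine Finset.sum_congr rfl fun z _ => ?_
  rcases Fin.exists_fin_two.1 ⟨(exoticGame c).signal a z, rfl⟩ with h | h <;> rw [h] <;> simp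

lemma indistinguishable_worst (c : ℝ) {x : Fin 8 → ℝ} (hx : x ∈ stdSimplex ℝ (Fin 8)) :
    (exoticGame c).Indistinguishable (worst x) x := by
  have h : ∀ a, (exoticGame c).signalLaw a (worst x) 1 = (exoticGame c).signalLaw a x 1 := by
    intro a
    rw [signalLaw_one, signalLaw_one]
    fin_cases a <;> (simp [worst]; try ring)
  intro a
  funext s
  fin_cases s
  · change (exoticGame c).signalLaw a (worst x) 0 = (exoticGame c).signalLaw a x 0
    rw [signalLaw_zero, signalLaw_zero, h, hx.2, (worst_mem hx).2]
  · exact h a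

lemma loss_le_of_indistinguishable {c : ℝ} {x y : Fin 8 → ℝ} (hx : x ∈ stdSimplex ℝ (Fin 8))
    (hy : y ∈ stdSimplex ℝ (Fin 8)) (h : (exoticGame c).Indistinguishable y x) (a : Fin 9) :
    ∑ z, y z * exoticLoss a z ≤ ∑ z, worst x z * exoticLoss a z := by
  have e : ∀ a, (exoticGame c).signalLaw a y 1 = (exoticGame c).signalLaw a x 1 :=
    fun a => congrFun (h a) 1
  simp only [signalLaw_one] at e
  have e4 := e 4
  have e5 := e 5
  have e6 := e 6
  have e7 := e 7
  have e8 := e 8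
  simp at e4 e5 e6 e7 e8
  obtain ⟨hx0, hx1⟩ := hx
  obtain ⟨hy0, hy1⟩ := hy
  have y1 := hy0 1
  have y3 := hy0 3
  have y5 := hy0 5
  have y7 := hy0 7
  simp only [Fin.sum_univ_eight] at hx1 hy1
  -- moving `k` units of mass to the even corners costs `k` units on both odd corners
  have k1 : y 0 - x 0 ≤ min (x 1) (x 3) := le_min (by linarith) (by linarith)
  have k2 : y 4 - x 4 ≤ min (x 5) (x 7) := le_min (by linarith) (by linarith)
  fin_cases a <;> simp [Fin.sum_univ_eight, worst, exoticLoss] <;> linarith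

lemma expectedLoss_exotic (c : ℝ) (π : Fin 9 → ℝ) (x : Fin 8 → ℝ) :
    (exoticGame c).expectedLoss π x = ∑ a, π a * (c * ∑ z, x z * exoticLoss a z) := by
  simp only [Game.expectedLoss, exoticGame, Finset.mul_sum]
  exact Finset.sum_congr rfl fun a _ => Finset.sum_congr rfl fun z _ => by ring

/-- The value is linear in the distribution of the action, since one distribution of the outcomes is
worst for all actions. -/
lemma value_exotic {c : ℝ} (hc : 0 < c) {π : Fin 9 → ℝ} (hπ : π ∈ stdSimplex ℝ (Fin 9))
    {x : Fin 8 → ℝ} (hx : x ∈ stdSimplex ℝ (Fin 8)) :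
    (exoticGame c).value π x = c * (mid x + (∑ a, π a * gap a x) / 2) := by
  have key : c * (mid x + (∑ a, π a * gap a x) / 2) = (exoticGame c).expectedLoss π (worst x) := by
    rw [expectedLoss_exotic]
    simp_rw [sum_worst_loss x hx.2]
    have : ∑ a, π a * (c * (mid x + gap a x / 2))
        = c * ((∑ a, π a) * mid x + (∑ a, π a * gap a x) / 2) := by
      rw [Finset.sum_mul, Finset.sum_div, ← Finset.sum_add_distrib, Finset.mul_sum]
      exact Finset.sum_congr rfl fun a _ => by ring
    rw [this, hπ.2, one_mul]
  refine IsGreatest.csSup_eq ⟨⟨worst x, worst_mem hx, indistinguishable_worst c hx, key⟩, ?_⟩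
  rintro r ⟨y, hy, hyx, rfl⟩
  rw [key, expectedLoss_exotic, expectedLoss_exotic]
  refine Finset.sum_le_sum fun a _ => mul_le_mul_of_nonneg_left ?_ (hπ.1 a)
  exact mul_le_mul_of_nonneg_left (loss_le_of_indistinguishable hx hy hyx a) hc.le

lemma abs_dev_le {x : Fin 8 → ℝ} (hx : x ∈ stdSimplex ℝ (Fin 8)) : |devL x| + |devR x| ≤ 1 := by
  obtain ⟨h0, h1⟩ := hx
  simp only [Fin.sum_univ_eight] at h1
  have n0 := h0 0
  have n1 := h0 1
  have n2 := h0 2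
  have n3 := h0 3
  have n4 := h0 4
  have n5 := h0 5
  have n6 := h0 6
  have n7 := h0 7
  have a1 : |devL x| ≤ x 1 + x 3 := abs_le.2 ⟨by simp [devL]; linarith, by simp [devL]; linarith⟩
  have a2 : |devR x| ≤ x 5 + x 7 := abs_le.2 ⟨by simp [devR]; linarith, by simp [devR]; linarith⟩
  linarith

lemma mid_mem {x : Fin 8 → ℝ} (hx : x ∈ stdSimplex ℝ (Fin 8)) : 0 ≤ mid x ∧ mid x ≤ 1 := by
  obtain ⟨h0, h1⟩ := hx
  simp only [Fin.sum_univ_eight] at h1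
  have n0 := h0 0
  have n1 := h0 1
  have n2 := h0 2
  have n3 := h0 3
  have n4 := h0 4
  have n5 := h0 5
  have n6 := h0 6
  have n7 := h0 7
  constructor <;> simp only [mid] <;> linarith

/-- No action has a value below `mid x - (|devL x| + |devR x|) / 2`. -/
lemma neg_abs_dev_le_gap {x : Fin 8 → ℝ} (hx : x ∈ stdSimplex ℝ (Fin 8)) (a : Fin 9) :
    -(|devL x| + |devR x|) ≤ gap a x := by
  have h1 := neg_abs_le (devL x)
  have h2 := neg_abs_le (devR x)
  have h3 := le_abs_self (devL x)
  have h4 := le_abs_self (devR x)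
  have h5 := abs_nonneg (devL x)
  have h6 := abs_nonneg (devR x)
  have h7 := mid_mem hx
  fin_cases a <;> simp [gap] <;> linarith

lemma gap_le {x : Fin 8 → ℝ} (hx : x ∈ stdSimplex ℝ (Fin 8)) (a : Fin 9) : gap a x ≤ 4 := by
  have h1 := neg_abs_le (devL x)
  have h2 := neg_abs_le (devR x)
  have h3 := le_abs_self (devL x)
  have h4 := le_abs_self (devR x)
  have h5 := abs_nonneg (devL x)
  have h6 := abs_nonneg (devR x)
  have h7 := mid_mem hx
  have h8 := abs_dev_le hx
  fin_cases a <;> simp [gap] <;> linarith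

lemma optValue_exotic {c : ℝ} (hc : 0 < c) {x : Fin 8 → ℝ} (hx : x ∈ stdSimplex ℝ (Fin 8)) :
    (exoticGame c).optValue x = c * (mid x - (|devL x| + |devR x|) / 2) := by
  refine IsLeast.csInf_eq ⟨?_, ?_⟩
  · -- one of the first two actions is optimal, according to the sign of `devR x`
    have hs : ∀ a : Fin 9, gap a x = -(|devL x| + |devR x|) →
        ∃ π ∈ stdSimplex ℝ (Fin 9),
          c * (mid x - (|devL x| + |devR x|) / 2) = (exoticGame c).value π x := by
      intro a ha
      refine ⟨Pi.single a 1, single_mem_stdSimplex ℝ a, ?_⟩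
      rw [value_exotic hc (single_mem_stdSimplex ℝ a) hx]
      simp [Pi.single_apply, ha]
      left; ring
    rcases le_total (devR x) 0 with h | h
    · exact hs 0 (by simp [gap, abs_of_nonpos h]; ring)
    · exact hs 1 (by simp [gap, abs_of_nonneg h]; ring)
  · rintro r ⟨π, hπ, rfl⟩
    rw [value_exotic hc hπ hx]
    refine mul_le_mul_of_nonneg_left ?_ hc.le
    have : ∑ a, π a * -(|devL x| + |devR x|) ≤ ∑ a, π a * gap a x :=
      Finset.sum_le_sum fun a _ => mul_le_mul_of_nonneg_left (neg_abs_dev_le_gap hx a) (hπ.1 a)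
    rw [← Finset.sum_mul, hπ.2] at this
    linarith

/-! ### The regret in terms of the imbalances -/

lemma average_mem {n : ℕ} (hn : n ≠ 0) (x : Fin n → stdSimplex ℝ (Fin 8)) :
    Game.average x ∈ stdSimplex ℝ (Fin 8) := by
  refine ⟨fun z => mul_nonneg (by positivity) (Finset.sum_nonneg fun t _ => (x t).2.1 z), ?_⟩
  simp only [Game.average]
  rw [← Finset.mul_sum, Finset.sum_comm]
  have : ∀ t, ∑ z, (x t : Fin 8 → ℝ) z = 1 := fun t => (x t).2.2
  simp [this, hn]

lemma natCast_mul_optValue_average {c : ℝ} (hc : 0 < c) (n : ℕ)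
    (x : ℕ → stdSimplex ℝ (Fin 8)) :
    n * (exoticGame c).optValue (Game.average fun i : Fin n => x i)
      = c * (∑ t ∈ range n, mid (x t)
        - (|∑ t ∈ range n, devL (x t)| + |∑ t ∈ range n, devR (x t)|) / 2) := by
  rcases eq_or_ne n 0 with rfl | hn
  · simp
  rw [optValue_exotic hc (average_mem hn _)]
  have hn' : (0 : ℝ) < n := by positivity
  have e : ∀ z, Game.average (fun i : Fin n => x i) z
      = (∑ t ∈ range n, (x t : Fin 8 → ℝ) z) / n := by
    intro z
    rw [Game.average, ← Fin.sum_univ_eq_sum_range (fun t => (x t : Fin 8 → ℝ) z)]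
    ring
  have hm : mid (Game.average fun i : Fin n => x i) = (∑ t ∈ range n, mid (x t)) / n := by
    simp only [mid, e, Finset.sum_add_distrib, ← Finset.sum_div]
    ring
  have hL : devL (Game.average fun i : Fin n => x i) = (∑ t ∈ range n, devL (x t)) / n := by
    simp only [devL, e, Finset.sum_sub_distrib]
    ring
  have hR : devR (Game.average fun i : Fin n => x i) = (∑ t ∈ range n, devR (x t)) / n := by
    simp only [devR, e, Finset.sum_sub_distrib]
    ring
  rw [hm, hL, hR, abs_div, abs_div, abs_of_pos hn']
  field_simp

/-- The expected value of `gap` at the action of round `t`. -/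
noncomputable def meanGap (c : ℝ) (ℓ : Learner (Fin 9) (Fin 2)) (x : ℕ → stdSimplex ℝ (Fin 8))
    (t : ℕ) : ℝ :=
  expect ((exoticGame c).obsKernel ℓ x) t fun h => ∑ a, (ℓ t h : Fin 9 → ℝ) a * gap a (x t)

lemma sum_expect_value {c : ℝ} (ℓ : Learner (Fin 9) (Fin 2))
    (x : ℕ → stdSimplex ℝ (Fin 8)) (n : ℕ) :
    ∑ t ∈ range n, expect ((exoticGame c).obsKernel ℓ x) t
        (fun h => c * (mid (x t) + (∑ a, (ℓ t h : Fin 9 → ℝ) a * gap a (x t)) / 2))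
      = c * (∑ t ∈ range n, mid (x t) + (∑ t ∈ range n, meanGap c ℓ x t) / 2) := by
  rw [Finset.sum_div, ← Finset.sum_add_distrib, Finset.mul_sum]
  refine Finset.sum_congr rfl fun t _ => ?_
  rw [expect_const_mul, expect_add, expect_const (Game.sum_obsKernel _ _ _), meanGap]
  congr 2
  rw [← one_div_mul_eq_div, ← expect_const_mul]
  congr 1
  funext h
  ring

lemma regret_exotic {c : ℝ} (hc : 0 < c) (ℓ : Learner (Fin 9) (Fin 2))
    (x : ℕ → stdSimplex ℝ (Fin 8)) (n : ℕ) :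
    (exoticGame c).regret ℓ (fun i : Fin n => x i)
      = c / 2 * (∑ t ∈ range n, meanGap c ℓ x t
        + |∑ t ∈ range n, devL (x t)| + |∑ t ∈ range n, devR (x t)|) := by
  rw [Game.regret, natCast_mul_optValue_average hc]
  have h := (exoticGame c).sum_pathProb_mul_sum ℓ x
    (fun t h _ => (exoticGame c).value (ℓ t h : Fin 9 → ℝ) (x t)) n
  simp only [Game.policyAt] at h ⊢
  rw [h]
  simp_rw [value_exotic hc (coe_mem_stdSimplex _) (coe_mem_stdSimplex _), ← Finset.sum_mul,
    sum_coe_stdSimplex, one_mul]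
  rw [sum_expect_value]
  ring

lemma sampledRegret_exotic {c : ℝ} (hc : 0 < c) (ℓ : Learner (Fin 9) (Fin 2))
    (x : ℕ → stdSimplex ℝ (Fin 8)) (n : ℕ) :
    (exoticGame c).sampledRegret ℓ (fun i : Fin n => x i)
      = c / 2 * (∑ t ∈ range n, meanGap c ℓ x t
        + |∑ t ∈ range n, devL (x t)| + |∑ t ∈ range n, devR (x t)|) := by
  rw [Game.sampledRegret, natCast_mul_optValue_average hc]
  rw [(exoticGame c).sum_pathProb_mul_sum ℓ x
    (fun t _ a => (exoticGame c).value (Pi.single a 1) (x t)) n]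
  have e : ∀ t h, ∑ a, (ℓ t h : Fin 9 → ℝ) a * (exoticGame c).value (Pi.single a 1) (x t)
      = c * (mid (x t) + (∑ a, (ℓ t h : Fin 9 → ℝ) a * gap a (x t)) / 2) := by
    intro t h
    have : ∀ a, (exoticGame c).value (Pi.single a 1) (x t) = c * (mid (x t) + gap a (x t) / 2) := by
      intro a
      rw [value_exotic hc (single_mem_stdSimplex ℝ a) (coe_mem_stdSimplex _)]
      simp [Pi.single_apply]
    simp_rw [this]
    calc _ = c * ((∑ a, (ℓ t h : Fin 9 → ℝ) a) * mid (x t)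
            + (∑ a, (ℓ t h : Fin 9 → ℝ) a * gap a (x t)) / 2) := by
          rw [Finset.sum_mul, Finset.sum_div, ← Finset.sum_add_distrib, Finset.mul_sum]
          exact Finset.sum_congr rfl fun a _ => by ring
      _ = _ := by rw [sum_coe_stdSimplex, one_mul]
  simp_rw [e]
  rw [sum_expect_value]
  ring

/-- Any finite sequence of distributions is the beginning of an infinite one. -/
lemma exists_extension {n : ℕ} (x : Fin n → stdSimplex ℝ (Fin 8)) :
    ∃ x' : ℕ → stdSimplex ℝ (Fin 8), x = fun i : Fin n => x' i :=
  ⟨fun t => if h : t < n then x ⟨t, h⟩ else ⟨Pi.single 0 1, single_mem_stdSimplex ℝ 0⟩, by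
    funext i; simp⟩

lemma sampledRegret_eq_regret {c : ℝ} (hc : 0 < c) (ℓ : Learner (Fin 9) (Fin 2)) {n : ℕ}
    (x : Fin n → stdSimplex ℝ (Fin 8)) :
    (exoticGame c).sampledRegret ℓ x = (exoticGame c).regret ℓ x := by
  obtain ⟨x, rfl⟩ := exists_extension x
  rw [regret_exotic hc, sampledRegret_exotic hc]

lemma minimaxSampledRegret_eq {c : ℝ} (hc : 0 < c) :
    (exoticGame c).minimaxSampledRegret = (exoticGame c).minimaxRegret := by
  funext n
  simp only [Game.minimaxSampledRegret, Game.minimaxRegret, sampledRegret_eq_regret hc]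

lemma bddAbove_regret {c : ℝ} (hc : 0 < c) (ℓ : Learner (Fin 9) (Fin 2)) (n : ℕ) :
    BddAbove (Set.range fun x : Fin n → stdSimplex ℝ (Fin 8) => (exoticGame c).regret ℓ x) := by
  refine ⟨c / 2 * (∑ _t ∈ range n, 4 + ∑ _t ∈ range n, 1), ?_⟩
  rintro _ ⟨x, rfl⟩
  obtain ⟨x, rfl⟩ := exists_extension x
  simp only
  rw [regret_exotic hc, add_assoc]
  refine mul_le_mul_of_nonneg_left (add_le_add (Finset.sum_le_sum fun t _ => ?_) ?_) (by positivity)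
  · rw [← expect_const (k := (exoticGame c).obsKernel ℓ x) (Game.sum_obsKernel _ _ _) t 4]
    refine expect_mono (Game.obsKernel_nonneg _ _ _) fun h => ?_
    calc ∑ a, (ℓ t h : Fin 9 → ℝ) a * gap a (x t) ≤ ∑ a, (ℓ t h : Fin 9 → ℝ) a * 4 :=
          Finset.sum_le_sum fun a _ =>
            mul_le_mul_of_nonneg_left (gap_le (coe_mem_stdSimplex _) a) ((ℓ t h).2.1 a)
      _ = 4 := by rw [← Finset.sum_mul, sum_coe_stdSimplex, one_mul]
  · refine (add_le_add (Finset.abs_sum_le_sum_abs _ _) (Finset.abs_sum_le_sum_abs _ _)).trans ?_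
    rw [← Finset.sum_add_distrib]
    exact Finset.sum_le_sum fun t _ => abs_dev_le (coe_mem_stdSimplex _)

/-! ### The lower bound -/

section Affinity

variable {O : Type}

/-- If `s` is the geometric mean of the kernels `p` and `q`, then its weights are the geometric means
of theirs. Their sum is the affinity of the two laws. -/
lemma weight_mul_weight {p q s : (t : ℕ) → (Fin t → O) → O → ℝ}
    (hs : ∀ t h o, s t h o ^ 2 = p t h o * q t h o) :
    ∀ t h, weight s t h ^ 2 = weight p t h * weight q t h
  | 0, _ => by simp [weight]
  | t + 1, h => by
    simp only [weight, mul_pow, hs, weight_mul_weight hs t]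
    ring

variable [Fintype O]

lemma expect_affinity_le {p q s : (t : ℕ) → (Fin t → O) → O → ℝ}
    (hp : ∀ t h o, 0 ≤ p t h o) (hq : ∀ t h o, 0 ≤ q t h o)
    (hs : ∀ t h o, s t h o ^ 2 = p t h o * q t h o) {t : ℕ} {F : (Fin t → O) → ℝ}
    (hF : ∀ h, 0 ≤ F h) : expect s t F ≤ (expect p t F + expect q t F) / 2 := by
  simp only [expect]
  rw [← Finset.sum_add_distrib, Finset.sum_div]
  refine Finset.sum_le_sum fun h _ => ?_
  have h1 := weight_nonneg hp t h
  have h2 := weight_nonneg hq t h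
  have h3 := weight_mul_weight hs t h
  have : weight s t h ≤ (weight p t h + weight q t h) / 2 :=
    le_of_sq_le_sq (by nlinarith [sq_nonneg (weight p t h - weight q t h)]) (by positivity)
  nlinarith [mul_le_mul_of_nonneg_right this (hF h)]

/-- Two laws with a large affinity cannot both avoid costs that never vanish together. -/
lemma affinity_le_expect {p q s : (t : ℕ) → (Fin t → O) → O → ℝ}
    (hp : ∀ t h o, 0 ≤ p t h o) (hq : ∀ t h o, 0 ≤ q t h o)
    (hp1 : ∀ t h, ∑ o, p t h o = 1) (hq1 : ∀ t h, ∑ o, q t h o = 1)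
    (hs : ∀ t h o, s t h o ^ 2 = p t h o * q t h o) {t : ℕ} {F F' : (Fin t → O) → ℝ} {κ : ℝ}
    (hκ : 0 ≤ κ) (hF : ∀ h, 0 ≤ F h) (hF' : ∀ h, 0 ≤ F' h) (hFF' : ∀ h, κ ≤ F h + F' h) :
    κ / 2 * (expect s t (fun _ => 1) - 1 / 4) ≤ expect p t F + expect q t F' := by
  have e : κ / 2 * (expect s t (fun _ => 1) - 1 / 4)
      = κ / 2 * (expect s t (fun _ => 1)
        - (expect p t (fun _ => 1) + expect q t (fun _ => 1)) / 8) := by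
    rw [expect_one hp1, expect_one hq1]; norm_num
  rw [e]
  simp only [expect, mul_one]
  rw [← Finset.sum_add_distrib, Finset.sum_div, ← Finset.sum_sub_distrib, Finset.mul_sum,
    ← Finset.sum_add_distrib]
  refine Finset.sum_le_sum fun h _ => ?_
  have h1 := weight_nonneg hp t h
  have h2 := weight_nonneg hq t h
  have h3 := weight_mul_weight hs t h
  -- the geometric mean is at most twice the minimum plus an eighth of the maximum
  have key : ∀ u v r : ℝ, 0 ≤ u → u ≤ v → r ^ 2 = u * v → r ≤ 2 * u + v / 8 := fun u v r hu hv hr =>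
    le_of_sq_le_sq (by nlinarith [sq_nonneg (2 * u - v / 8)]) (by linarith)
  have h4 := hF h
  have h5 := hF' h
  have h6 := hFF' h
  rcases le_total (weight p t h) (weight q t h) with h' | h'
  · have := key _ _ _ h1 h' h3
    nlinarith [mul_nonneg (sub_nonneg.2 h') h5, mul_nonneg h1 (sub_nonneg.2 h6),
      mul_le_mul_of_nonneg_left this hκ, mul_nonneg hκ h1]
  · have := key _ _ _ h2 h' (by rw [h3]; ring)
    nlinarith [mul_nonneg (sub_nonneg.2 h') h4, mul_nonneg h2 (sub_nonneg.2 h6),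
      mul_le_mul_of_nonneg_left this hκ, mul_nonneg hκ h2]

end Affinity

/-- The distribution with imbalances `e` and `e'` that is used in the lower bound. -/
noncomputable def envFun (e e' : ℝ) : Fin 8 → ℝ :=
  ![1 / 8, 1 / 8 + e / 2, 1 / 8, 1 / 8 - e / 2, 1 / 8, 1 / 8 + e' / 2, 1 / 8, 1 / 8 - e' / 2]

lemma envFun_mem {e e' : ℝ} (he : |e| ≤ 1 / 4) (he' : |e'| ≤ 1 / 4) :
    envFun e e' ∈ stdSimplex ℝ (Fin 8) := by
  rw [abs_le] at he he'
  refine ⟨fun z => ?_, ?_⟩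
  · fin_cases z <;> simp [envFun] <;> linarith
  · simp [envFun, Fin.sum_univ_eight]; ring

lemma devL_envFun (e e' : ℝ) : devL (envFun e e') = e := by simp [devL, envFun]

lemma devR_envFun (e e' : ℝ) : devR (envFun e e') = e' := by simp [devR, envFun]

lemma mid_envFun (e e' : ℝ) : mid (envFun e e') = 1 / 2 := by simp [mid, envFun]; ring

/-- The excess of an action over the best action. -/
noncomputable def excess (a : Fin 9) (x : Fin 8 → ℝ) : ℝ := gap a x + (|devL x| + |devR x|)

lemma excess_nonneg {x : Fin 8 → ℝ} (hx : x ∈ stdSimplex ℝ (Fin 8)) (a : Fin 9) :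
    0 ≤ excess a x := by
  have := neg_abs_dev_le_gap hx a
  simp only [excess]
  linarith

lemma le_excess_add_excess {e e' : ℝ} (he : 0 ≤ e) (hee' : e ≤ e')
    (a : Fin 9) : 2 * e ≤ excess a (envFun e e') + excess a (envFun (-e) (-e')) := by
  fin_cases a <;>
    simp [excess, gap, devL_envFun, devR_envFun, mid_envFun, abs_of_nonneg he,
      abs_of_nonneg (he.trans hee')] <;> linarith

lemma one_sub_le_sqrt {u : ℝ} (h0 : 0 ≤ u) (h1 : u ≤ 1) : 1 - u ≤ Real.sqrt (1 - u) :=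
  Real.le_sqrt_of_sq_le (by nlinarith)

/-- The affinity of two Bernoulli distributions. -/
noncomputable def bernoulliAffinity (u v : ℝ) : ℝ :=
  Real.sqrt ((1 - u) * (1 - v)) + Real.sqrt (u * v)

lemma bernoulliAffinity_self {u : ℝ} (h0 : 0 ≤ u) (h1 : u ≤ 1) : bernoulliAffinity u u = 1 := by
  rw [bernoulliAffinity, Real.sqrt_mul_self (by linarith), Real.sqrt_mul_self h0]
  ring

lemma le_bernoulliAffinity {e : ℝ} (he : |e| ≤ 1 / 4) :
    1 - 2 * e ^ 2 ≤ bernoulliAffinity (1 / 4 + e / 2) (1 / 4 + -e / 2) := by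
  have h2 : e ^ 2 ≤ (1 / 4) ^ 2 := by rw [← sq_abs]; gcongr
  have e1 : (1 - (1 / 4 + e / 2)) * (1 - (1 / 4 + -e / 2))
      = (3 / 4) ^ 2 * (1 - 4 / 9 * e ^ 2) := by ring
  have e2 : (1 / 4 + e / 2) * (1 / 4 + -e / 2) = (1 / 4) ^ 2 * (1 - 4 * e ^ 2) := by ring
  rw [bernoulliAffinity, e1, e2, Real.sqrt_mul (by positivity), Real.sqrt_mul (by positivity),
    Real.sqrt_sq (by positivity), Real.sqrt_sq (by positivity)]
  have := one_sub_le_sqrt (u := 4 / 9 * e ^ 2) (by positivity) (by linarith)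
  have := one_sub_le_sqrt (u := 4 * e ^ 2) (by positivity) (by linarith)
  nlinarith [sq_nonneg e]

lemma signalLaw_envFun (c e e' : ℝ) (a : Fin 9) :
    (exoticGame c).signalLaw a (envFun e e') 1
      = ![0, 0, 0, 0, 1 / 4 + e / 2, 1 / 4 + e / 2, 1 / 2, 1 / 4 + e' / 2, 1 / 4 + e' / 2] a := by
  rw [signalLaw_one]
  fin_cases a <;> simp [envFun] <;> ring

/-- An action separates the two environments only as far as it is costly in both. -/
lemma one_sub_excess_le_affinity {c e e' θ : ℝ} (he : 0 ≤ e) (he' : 0 ≤ e') (hee : e ≤ 1 / 4)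
    (hee' : e' ≤ 1 / 4) (h1 : 4 * e ^ 2 ≤ θ * e') (h2 : e' ^ 2 ≤ θ) {x : Fin 8 → ℝ}
    (hx : x = envFun e e' ∨ x = envFun (-e) (-e')) (a : Fin 9) :
    1 - θ * excess a x
      ≤ ∑ s, Real.sqrt ((exoticGame c).signalLaw a (envFun e e') s
          * (exoticGame c).signalLaw a (envFun (-e) (-e')) s) := by
  have ae : |e| ≤ 1 / 4 := by rwa [abs_of_nonneg he]
  have ae' : |e'| ≤ 1 / 4 := by rwa [abs_of_nonneg he']
  have m1 := envFun_mem ae ae'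
  have m2 : envFun (-e) (-e') ∈ stdSimplex ℝ (Fin 8) :=
    envFun_mem (by rwa [abs_neg]) (by rwa [abs_neg])
  have hθ : 0 ≤ θ := (sq_nonneg _).trans h2
  have hL : |devL x| = e := by
    rcases hx with rfl | rfl <;> simp [devL_envFun, abs_of_nonneg he]
  have hR : |devR x| = e' := by
    rcases hx with rfl | rfl <;> simp [devR_envFun, abs_of_nonneg he']
  have hM : mid x = 1 / 2 := by
    rcases hx with rfl | rfl <;> simp [mid_envFun]
  have hm : x ∈ stdSimplex ℝ (Fin 8) := by rcases hx with rfl | rfl <;> assumption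
  have hpos : 1 - θ * excess a x ≤ 1 := by linarith [mul_nonneg hθ (excess_nonneg hm a)]
  have cL : ∀ r, r = (e + e') / 2 →
      1 - θ * r ≤ bernoulliAffinity (1 / 4 + e / 2) (1 / 4 + -e / 2) := by
    rintro _ rfl
    nlinarith [le_bernoulliAffinity ae, mul_nonneg hθ he]
  have cR : ∀ r, 2 ≤ r →
      1 - θ * r ≤ bernoulliAffinity (1 / 4 + e' / 2) (1 / 4 + -e' / 2) := fun r hr => by
    nlinarith [le_bernoulliAffinity ae', mul_le_mul_of_nonneg_left hr hθ]
  have c0 : ∀ u : ℝ, 0 ≤ u → u ≤ 1 → 1 - θ * excess a x ≤ bernoulliAffinity u u :=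
    fun u hu0 hu1 => by rwa [bernoulliAffinity_self hu0 hu1]
  rw [Fin.sum_univ_two, signalLaw_zero, signalLaw_zero, signalLaw_envFun, signalLaw_envFun,
    m1.2, m2.2]
  fin_cases a
  · exact c0 0 le_rfl zero_le_one
  · exact c0 0 le_rfl zero_le_one
  · exact c0 0 le_rfl zero_le_one
  · exact c0 0 le_rfl zero_le_one
  · exact cL _ (by simp [excess, gap, hL, hR]; ring)
  · exact cL _ (by simp [excess, gap, hL, hR]; ring)
  · exact c0 (1 / 2) (by norm_num) (by norm_num)
  · exact cR _ (by simp [excess, gap, hL, hR, hM]; linarith)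
  · exact cR _ (by simp [excess, gap, hL, hR, hM]; linarith)

/-- The expected excess of round `t` when all outcomes have the distribution `x`. -/
noncomputable def meanExcess (c : ℝ) (ℓ : Learner (Fin 9) (Fin 2)) (x : stdSimplex ℝ (Fin 8))
    (t : ℕ) : ℝ :=
  expect ((exoticGame c).obsKernel ℓ fun _ => x) t
    fun h => ∑ a, (ℓ t h : Fin 9 → ℝ) a * excess a x

lemma meanExcess_eq (c : ℝ) (ℓ : Learner (Fin 9) (Fin 2)) (x : stdSimplex ℝ (Fin 8)) (t : ℕ) :
    meanExcess c ℓ x t = meanGap c ℓ (fun _ => x) t + (|devL x| + |devR x|) := by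
  have : ∀ h, ∑ a, (ℓ t h : Fin 9 → ℝ) a * excess a x
      = ∑ a, (ℓ t h : Fin 9 → ℝ) a * gap a x + (|devL x| + |devR x|) := fun h => by
    simp only [excess, mul_add, Finset.sum_add_distrib, ← Finset.sum_mul, sum_coe_stdSimplex,
      one_mul]
  simp_rw [meanExcess, this]
  rw [expect_add, expect_const (Game.sum_obsKernel _ _ _), meanGap]

/-- Against a constant adversary, the regret is the expected total excess. -/
lemma regret_const {c : ℝ} (hc : 0 < c) (ℓ : Learner (Fin 9) (Fin 2)) (x : stdSimplex ℝ (Fin 8))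
    (n : ℕ) : (exoticGame c).regret ℓ (fun _ : Fin n => x)
      = c / 2 * ∑ t ∈ range n, meanExcess c ℓ x t := by
  rw [regret_exotic hc ℓ (fun _ => x) n]
  simp only [meanExcess_eq, Finset.sum_add_distrib, Finset.sum_const, card_range, nsmul_eq_mul,
    abs_mul, Nat.abs_cast]
  ring

/-- The total excess in two opposite environments: either their laws are close, and the learner
cannot serve both, or they have been separated, at a cost. -/
lemma sum_meanExcess_ge {c e e' θ : ℝ} (he : 0 ≤ e) (hee : e ≤ e')
    (hee' : e' ≤ 1 / 4) (h1 : 4 * e ^ 2 ≤ θ * e') (h2 : e' ^ 2 ≤ θ)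
    (ℓ : Learner (Fin 9) (Fin 2)) {x y : stdSimplex ℝ (Fin 8)}
    (hx : (x : Fin 8 → ℝ) = envFun e e') (hy : (y : Fin 8 → ℝ) = envFun (-e) (-e')) (n : ℕ) :
    n * e * (3 / 4 - θ / 2 * ∑ t ∈ range n, (meanExcess c ℓ x t + meanExcess c ℓ y t))
      ≤ ∑ t ∈ range n, (meanExcess c ℓ x t + meanExcess c ℓ y t) := by
  have he' := he.trans hee
  have hθ : 0 ≤ θ := (sq_nonneg _).trans h2
  set p := (exoticGame c).obsKernel ℓ fun _ => x with hp
  set q := (exoticGame c).obsKernel ℓ fun _ => y with hq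
  set r : (t : ℕ) → (Fin t → Fin 9 × Fin 2) → Fin 9 × Fin 2 → ℝ := fun t h o =>
    (ℓ t h : Fin 9 → ℝ) o.1 * Real.sqrt ((exoticGame c).signalLaw o.1 x o.2
      * (exoticGame c).signalLaw o.1 y o.2) with hr
  have hp0 := (exoticGame c).obsKernel_nonneg ℓ fun _ => x
  have hq0 := (exoticGame c).obsKernel_nonneg ℓ fun _ => y
  have hlaw : ∀ (w : stdSimplex ℝ (Fin 8)) a s, 0 ≤ (exoticGame c).signalLaw a w s :=
    fun w a s => Game.signalLaw_nonneg _ w.2 a s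
  have hr0 : ∀ t h o, 0 ≤ r t h o := fun t h o =>
    mul_nonneg ((ℓ t h).2.1 _) (Real.sqrt_nonneg _)
  have hrpq : ∀ t h o, r t h o ^ 2 = p t h o * q t h o := fun t h o => by
    simp only [hr, hp, hq, Game.obsKernel, mul_pow]
    rw [Real.sq_sqrt (mul_nonneg (hlaw _ _ _) (hlaw _ _ _))]
    ring
  have hxm : ∀ (w : stdSimplex ℝ (Fin 8)) t h, 0 ≤ ∑ a, (ℓ t h : Fin 9 → ℝ) a * excess a w :=
    fun w t h => Finset.sum_nonneg fun a _ =>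
      mul_nonneg ((ℓ t h).2.1 _) (excess_nonneg (coe_mem_stdSimplex _) a)
  -- the excess of round `t` in the two environments together
  set Y : ℕ → ℝ := fun t => meanExcess c ℓ x t + meanExcess c ℓ y t with hY
  have hY0 : ∀ t, 0 ≤ Y t := fun t =>
    add_nonneg (expect_nonneg hp0 (hxm x t)) (expect_nonneg hq0 (hxm y t))
  -- the affinity of the two laws after `t` rounds
  have hB : ∀ t, 1 - θ / 2 * ∑ s ∈ range t, Y s ≤ expect r t fun _ => 1 := by
    intro t
    induction t with
    | zero => simp [expect_zero]
    | succ t ih =>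
      rw [expect_succ, Finset.sum_range_succ]
      have hstep : ∀ h, 1 - θ * ∑ a, (ℓ t h : Fin 9 → ℝ) a * min (excess a x) (excess a y)
          ≤ ∑ o, r t h o * 1 := by
        intro h
        simp only [mul_one, hr]
        rw [Fintype.sum_prod_type]
        simp only [← Finset.mul_sum]
        calc _ = ∑ a, (ℓ t h : Fin 9 → ℝ) a * (1 - θ * min (excess a x) (excess a y)) := by
              simp only [mul_sub, mul_one, Finset.sum_sub_distrib, sum_coe_stdSimplex,
                Finset.mul_sum]
              congr 1
              exact Finset.sum_congr rfl fun a _ => by ring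
          _ ≤ _ := by
              refine Finset.sum_le_sum fun a _ => mul_le_mul_of_nonneg_left ?_ ((ℓ t h).2.1 a)
              rw [hx, hy]
              rcases min_choice (excess a (envFun e e')) (excess a (envFun (-e) (-e'))) with h | h
              · rw [h]
                exact one_sub_excess_le_affinity he he' (hee.trans hee') hee' h1 h2 (Or.inl rfl) a
              · rw [h]
                exact one_sub_excess_le_affinity he he' (hee.trans hee') hee' h1 h2 (Or.inr rfl) a
      have hle := expect_mono hr0 hstep
      rw [expect_sub, expect_const_mul] at hle
      have : expect r t (fun h => ∑ a, (ℓ t h : Fin 9 → ℝ) a * min (excess a x) (excess a y))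
          ≤ Y t / 2 := by
        refine (expect_affinity_le (F := fun h =>
            ∑ a, (ℓ t h : Fin 9 → ℝ) a * min (excess a x) (excess a y)) hp0 hq0 hrpq
          fun h => Finset.sum_nonneg fun a _ => mul_nonneg ((ℓ t h).2.1 _)
            (le_min (excess_nonneg (coe_mem_stdSimplex _) a)
              (excess_nonneg (coe_mem_stdSimplex _) a))).trans ?_
        have i1 := expect_mono hp0 (t := t) (F := fun h =>
            ∑ a, (ℓ t h : Fin 9 → ℝ) a * min (excess a x) (excess a y))
          (F' := fun h => ∑ a, (ℓ t h : Fin 9 → ℝ) a * excess a x) fun h =>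
            Finset.sum_le_sum fun a _ =>
              mul_le_mul_of_nonneg_left (min_le_left _ _) ((ℓ t h).2.1 a)
        have i2 := expect_mono hq0 (t := t) (F := fun h =>
            ∑ a, (ℓ t h : Fin 9 → ℝ) a * min (excess a x) (excess a y))
          (F' := fun h => ∑ a, (ℓ t h : Fin 9 → ℝ) a * excess a y) fun h =>
            Finset.sum_le_sum fun a _ =>
              mul_le_mul_of_nonneg_left (min_le_right _ _) ((ℓ t h).2.1 a)
        simp only [hY, meanExcess]
        linarith
      nlinarith [mul_le_mul_of_nonneg_left this hθ]
  have hround : ∀ t ∈ range n, e * (3 / 4 - θ / 2 * ∑ s ∈ range n, Y s) ≤ Y t := by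
    intro t ht
    have i1 := affinity_le_expect (t := t) (κ := 2 * e) hp0 hq0 (Game.sum_obsKernel _ _ _)
      (Game.sum_obsKernel _ _ _) hrpq (by linarith) (hxm x t) (hxm y t) (fun h => by
        rw [← Finset.sum_add_distrib]
        calc 2 * e = ∑ a, (ℓ t h : Fin 9 → ℝ) a * (2 * e) := by
              rw [← Finset.sum_mul, sum_coe_stdSimplex, one_mul]
          _ ≤ _ := Finset.sum_le_sum fun a _ => by
              rw [← mul_add, hx, hy]
              exact mul_le_mul_of_nonneg_left (le_excess_add_excess he hee a) ((ℓ t h).2.1 a))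
    have i2 : ∑ s ∈ range t, Y s ≤ ∑ s ∈ range n, Y s :=
      Finset.sum_le_sum_of_subset_of_nonneg
        (Finset.range_subset_range.2 (Finset.mem_range.1 ht).le) fun s _ _ => hY0 s
    refine le_trans ?_ i1
    rw [mul_div_cancel_left₀ _ (two_ne_zero)]
    refine mul_le_mul_of_nonneg_left ?_ he
    have i3 := hB t
    have i4 := mul_le_mul_of_nonneg_left i2 (by linarith : (0 : ℝ) ≤ θ / 2)
    linarith
  have := Finset.card_nsmul_le_sum _ _ _ hround
  rw [card_range, nsmul_eq_mul] at this
  linarith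

/-- The worst-case regret of any learner is at least of order `ρ⁻⁴`, where `n = ρ⁻⁷`: two
environments with imbalances of orders `ρ³` and `ρ²` cannot be separated more cheaply. -/
lemma iSup_regret_ge {c : ℝ} (hc : 0 < c) {n : ℕ} {ρ : ℝ} (hρ0 : 0 < ρ) (hρ1 : ρ ≤ 1)
    (hn : n * ρ ^ 7 = 1) (ℓ : Learner (Fin 9) (Fin 2)) :
    c / 100 * (1 / ρ ^ 4) ≤ ⨆ x : Fin n → stdSimplex ℝ (Fin 8), (exoticGame c).regret ℓ x := by
  have hρ2 : ρ ^ 2 ≤ 1 := pow_le_one₀ hρ0.le hρ1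
  have hρ3 : ρ ^ 3 ≤ ρ ^ 2 := pow_le_pow_of_le_one hρ0.le hρ1 (by norm_num)
  have ae : |ρ ^ 3 / 4| ≤ 1 / 4 := by rw [abs_of_pos (by positivity)]; linarith
  have ae' : |ρ ^ 2 / 4| ≤ 1 / 4 := by rw [abs_of_pos (by positivity)]; linarith
  set x : stdSimplex ℝ (Fin 8) := ⟨envFun (ρ ^ 3 / 4) (ρ ^ 2 / 4), envFun_mem ae ae'⟩ with hx
  set y : stdSimplex ℝ (Fin 8) := ⟨envFun (-(ρ ^ 3 / 4)) (-(ρ ^ 2 / 4)),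
    envFun_mem (by rwa [abs_neg]) (by rwa [abs_neg])⟩ with hy
  have key := sum_meanExcess_ge (c := c) (e := ρ ^ 3 / 4) (e' := ρ ^ 2 / 4) (θ := ρ ^ 4)
    (by positivity) (by linarith) (by linarith)
    (by nlinarith [pow_pos hρ0 6]) (by nlinarith [pow_pos hρ0 4]) ℓ (x := x) (y := y) rfl rfl n
  have h1 := le_ciSup (bddAbove_regret hc ℓ n) (fun _ => x)
  have h2 := le_ciSup (bddAbove_regret hc ℓ n) (fun _ => y)
  simp only [regret_const hc] at h1 h2
  rw [Finset.sum_add_distrib] at key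
  set X := ∑ t ∈ range n, meanExcess c ℓ x t
  set Y := ∑ t ∈ range n, meanExcess c ℓ y t
  set s := ⨆ z : Fin n → stdSimplex ℝ (Fin 8), (exoticGame c).regret ℓ z
  have hne : n * (ρ ^ 3 / 4) = 1 / ρ ^ 4 / 4 := by
    field_simp
    linarith
  rw [hne] at key
  have hXY : 1 / ρ ^ 4 / 25 * 4 ≤ X + Y := by
    have e : 1 / ρ ^ 4 / 4 * (3 / 4 - ρ ^ 4 / 2 * (X + Y))
        = 3 / 16 * (1 / ρ ^ 4) - (X + Y) / 8 := by
      field_simp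
      ring
    rw [e] at key
    have : 0 < 1 / ρ ^ 4 := by positivity
    linarith
  have : 0 < c * (1 / ρ ^ 4) := by positivity
  nlinarith [mul_le_mul_of_nonneg_left hXY hc.le]

lemma minimaxRegret_ge {c : ℝ} (hc : 0 < c) {n : ℕ} {ρ : ℝ} (hρ0 : 0 < ρ) (hρ1 : ρ ≤ 1)
    (hn : n * ρ ^ 7 = 1) : c / 100 * (1 / ρ ^ 4) ≤ (exoticGame c).minimaxRegret n :=
  le_ciInf fun ℓ => iSup_regret_ge hc hρ0 hρ1 hn ℓ

/-! ### Potential functions -/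

section Potentials

/-- The potential `log (cosh (η y)) / η`, a smooth version of `|y|` with derivative
`tanh (η y)`. -/
noncomputable def coshPotential (η y : ℝ) : ℝ := Real.log (Real.cosh (η * y)) / η

lemma abs_sub_le_coshPotential {η : ℝ} (hη : 0 < η) (y : ℝ) :
    |y| - Real.log 2 / η ≤ coshPotential η y := by
  have h : η * |y| - Real.log 2 ≤ Real.log (Real.cosh (η * y)) := by
    rw [Real.le_log_iff_exp_le (Real.cosh_pos _), Real.exp_sub, Real.exp_log two_pos,
      ← Real.cosh_abs (η * y), abs_mul, abs_of_pos hη, Real.cosh_eq]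
    have := Real.exp_pos (-(η * |y|))
    linarith
  rw [coshPotential, le_div_iff₀ hη, sub_mul, div_mul_cancel₀ _ hη.ne']
  linarith

lemma one_sub_exp_neg_ge {b : ℝ} (hb : |b| ≤ 1 / 2) :
    b - 2 * b ^ 2 ≤ (1 - Real.exp (-(2 * b))) / 2 := by
  have h := Real.abs_exp_sub_one_sub_id_le (x := -(2 * b))
    (by rw [abs_neg, abs_mul, abs_two]; linarith)
  have := (abs_le.1 h).2
  nlinarith

lemma log_cosh_add_le_aux {a b : ℝ} (hb : |b| ≤ 1 / 2) :
    Real.log (Real.cosh (a + b)) - Real.log (Real.cosh a)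
      ≤ Real.tanh a * b + 2 * (1 - Real.tanh a) * b ^ 2 := by
  have hc := Real.cosh_pos a
  have ht : Real.tanh a < 1 := Real.tanh_lt_one a
  have e : Real.cosh (a + b)
      = Real.cosh a * (Real.exp b * (1 - (1 - Real.tanh a) * ((1 - Real.exp (-(2 * b))) / 2))) := by
    have h1 : Real.exp b * Real.exp (-(2 * b)) = Real.exp (-b) := by
      rw [← Real.exp_add]; ring_nf
    have h2 : Real.cosh a * Real.tanh a = Real.sinh a := by
      rw [Real.tanh_eq_sinh_div_cosh, mul_div_cancel₀ _ hc.ne']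
    have h3 : Real.cosh b = (Real.exp b + Real.exp (-b)) / 2 := Real.cosh_eq b
    have h4 : Real.sinh b = (Real.exp b - Real.exp (-b)) / 2 := Real.sinh_eq b
    rw [Real.cosh_add, h3, h4, ← h2, ← h1]
    ring
  have hpos : 0 < 1 - (1 - Real.tanh a) * ((1 - Real.exp (-(2 * b))) / 2) := by
    have := Real.cosh_pos (a + b)
    rw [e] at this
    exact pos_of_mul_pos_right (pos_of_mul_pos_right this hc.le) (Real.exp_pos b).le
  rw [e, Real.log_mul hc.ne' (by positivity), Real.log_mul (Real.exp_pos b).ne' hpos.ne',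
    Real.log_exp]
  have h1 := Real.log_le_sub_one_of_pos hpos
  have h2 := mul_le_mul_of_nonneg_left (one_sub_exp_neg_ge hb) (sub_nonneg.2 ht.le)
  nlinarith

lemma log_cosh_add_le {a b : ℝ} (hb : |b| ≤ 1 / 2) :
    Real.log (Real.cosh (a + b)) - Real.log (Real.cosh a)
      ≤ Real.tanh a * b + 2 * (1 - Real.tanh a ^ 2) * b ^ 2 := by
  have h1 := Real.tanh_lt_one a
  have h2 := Real.neg_one_lt_tanh a
  rcases le_total 0 (Real.tanh a) with h | h
  · refine (log_cosh_add_le_aux hb).trans ?_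
    nlinarith [mul_nonneg (mul_nonneg h (sub_nonneg.2 h1.le)) (sq_nonneg b)]
  · have := log_cosh_add_le_aux (a := -a) (b := -b) (by rwa [abs_neg])
    rw [← neg_add, Real.cosh_neg, Real.cosh_neg, Real.tanh_neg] at this
    refine this.trans ?_
    nlinarith [mul_nonneg (mul_nonneg (neg_nonneg.2 h) (by linarith : 0 ≤ 1 + Real.tanh a))
      (sq_nonneg b)]

/-- The second-order term of the potential vanishes where the derivative saturates. -/
lemma coshPotential_add_le {η : ℝ} (hη : 0 < η) {y j : ℝ} (hj : |η * j| ≤ 1 / 2) :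
    coshPotential η (y + j) ≤ coshPotential η y + Real.tanh (η * y) * j
      + 2 * η * (1 - Real.tanh (η * y) ^ 2) * j ^ 2 := by
  have h := log_cosh_add_le (a := η * y) hj
  rw [coshPotential, coshPotential, mul_add, div_le_iff₀ hη, add_mul, add_mul,
    div_mul_cancel₀ _ hη.ne']
  nlinarith

/-- The piecewise linear function that rises from `0` at `K` to `1` at `2 * K`. -/
noncomputable def ramp (K y : ℝ) : ℝ := (max 0 (y - K) - max 0 (y - 2 * K)) / K

/-- The primitive of `ramp K` that vanishes at `0`. -/
noncomputable def rampPotential (K y : ℝ) : ℝ :=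
  (max 0 (y - K) ^ 2 - max 0 (y - 2 * K) ^ 2) / (2 * K)

lemma ramp_nonneg {K : ℝ} (hK : 0 < K) (y : ℝ) : 0 ≤ ramp K y :=
  div_nonneg (sub_nonneg.2 (max_le_max le_rfl (by linarith))) hK.le

lemma ramp_le_one {K : ℝ} (hK : 0 < K) (y : ℝ) : ramp K y ≤ 1 := by
  rw [ramp, div_le_one hK, sub_le_iff_le_add]
  exact max_le (by positivity) (by linarith [le_max_right 0 (y - 2 * K)])

lemma ramp_of_le {K y : ℝ} (hK : 0 < K) (hy : y ≤ K) : ramp K y = 0 := by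
  rw [ramp, max_eq_left (by linarith), max_eq_left (by linarith)]
  simp

lemma rampPotential_zero {K : ℝ} (hK : 0 < K) : rampPotential K 0 = 0 := by
  rw [rampPotential, max_eq_left (by linarith), max_eq_left (by linarith)]
  simp

lemma rampPotential_nonneg {K : ℝ} (hK : 0 < K) (y : ℝ) : 0 ≤ rampPotential K y :=
  div_nonneg (sub_nonneg.2 (pow_le_pow_left₀ (le_max_left _ _) (max_le_max le_rfl (by linarith)) 2))
    (by positivity)

lemma le_rampPotential {K : ℝ} (hK : 0 < K) (y : ℝ) : y - 3 / 2 * K ≤ rampPotential K y := by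
  rw [rampPotential, le_div_iff₀ (by positivity)]
  rcases le_total (y - K) 0 with h | h <;> rcases le_total (y - 2 * K) 0 with h' | h' <;>
    simp only [h, h', max_eq_left, max_eq_right] <;>
    nlinarith [sq_nonneg (y - 2 * K)]

lemma rampPotential_add_le {K : ℝ} (hK : 0 < K) (y j : ℝ) :
    rampPotential K (y + j) ≤ rampPotential K y + ramp K y * j + j ^ 2 / (2 * K) := by
  have e : rampPotential K y + ramp K y * j + j ^ 2 / (2 * K)
      = (max 0 (y - K) ^ 2 - max 0 (y - 2 * K) ^ 2
        + 2 * (max 0 (y - K) - max 0 (y - 2 * K)) * j + j ^ 2) / (2 * K) := by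
    rw [rampPotential, ramp]
    field_simp
  rw [e, rampPotential]
  refine div_le_div_of_nonneg_right ?_ (by positivity)
  rcases le_total (y - K) 0 with h | h <;> rcases le_total (y - 2 * K) 0 with h' | h' <;>
    rcases le_total (y + j - K) 0 with k | k <;> rcases le_total (y + j - 2 * K) 0 with k' | k' <;>
    simp only [h, h', k, k', max_eq_left, max_eq_right] <;>
    nlinarith [sq_nonneg j, sq_nonneg (y + j - 2 * K), sq_nonneg (y + j - K),
      sq_nonneg (y - 2 * K), sq_nonneg (y - K)]

/-- An even potential, close to `|y|`, whose derivative `ramp K y - ramp K (-y)` vanishes on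
`[-K, K]`. -/
noncomputable def evenRampPotential (K y : ℝ) : ℝ := rampPotential K y + rampPotential K (-y)

lemma abs_sub_le_evenRampPotential {K : ℝ} (hK : 0 < K) (y : ℝ) :
    |y| - 3 / 2 * K ≤ evenRampPotential K y := by
  have h1 := le_rampPotential hK y
  have h2 := le_rampPotential hK (-y)
  have h3 := rampPotential_nonneg hK y
  have h4 := rampPotential_nonneg hK (-y)
  rw [evenRampPotential]
  rcases abs_cases y with h | h <;> linarith

lemma evenRampPotential_add_le {K : ℝ} (hK : 0 < K) (y j : ℝ) :
    evenRampPotential K (y + j)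
      ≤ evenRampPotential K y + (ramp K y - ramp K (-y)) * j + j ^ 2 / K := by
  have h1 := rampPotential_add_le hK y j
  have h2 := rampPotential_add_le hK (-y) (-j)
  rw [← neg_add] at h2
  have h3 : j ^ 2 / K = j ^ 2 / (2 * K) + (-j) ^ 2 / (2 * K) := by field_simp; ring
  rw [evenRampPotential, evenRampPotential, h3]
  linarith

/-- For `K > 0` the two ramps are never positive together. -/
lemma ramp_add_ramp_neg_le_one {K : ℝ} (hK : 0 < K) (y : ℝ) : ramp K y + ramp K (-y) ≤ 1 := by
  rcases le_total y 0 with h | h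
  · rw [ramp_of_le hK (h.trans hK.le), zero_add]
    exact ramp_le_one hK _
  · rw [ramp_of_le hK (by linarith : -y ≤ K), add_zero]
    exact ramp_le_one hK _

end Potentials

/-! ### One round of the learner -/

/-- A bound for the loss of a mixture of the four actions with small loss (`q` is the mean sign on
the first square, `g` its rate of exploration). -/
lemma mixture_bounds {b g q r r' L R γ : ℝ} (h1 : 0 ≤ r) (h2 : 0 ≤ r') (h3 : 0 ≤ b)
    (hb : b = 1 - (r + r')) (h4 : 0 ≤ g) (h5 : g ≤ 1) (hγ : g ≤ γ) (hq : |q| ≤ 1)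
    (hLR : |L| + |R| ≤ 1) :
    -1 ≤ r' * (R - |L|) + r * (-R - |L|)
        + b * ((1 - g) * (-q * L - |R|) - g * (|L| + |R|) / 2) ∧
      r' * (R - |L|) + r * (-R - |L|) + b * ((1 - g) * (-q * L - |R|) - g * (|L| + |R|) / 2)
        ≤ -(b * (q * (1 - g / 2)) * L + (1 - b) * |L|)
          - ((1 - γ / 2) * b * |R| + (r - r') * R) := by
  have aL := abs_nonneg L
  have aR := abs_nonneg R
  have hqL : q * L ≤ |L| := (le_abs_self _).trans (by
    rw [abs_mul]; exact mul_le_of_le_one_left aL hq)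
  constructor
  · have i1 : -1 ≤ (1 - g) * (-q * L - |R|) - g * (|L| + |R|) / 2 := by
      have i2 : (1 - g) * (-1) ≤ (1 - g) * (-q * L - |R|) :=
        mul_le_mul_of_nonneg_left (by linarith) (by linarith)
      have i3 : g * (|L| + |R|) ≤ g * 1 := mul_le_mul_of_nonneg_left hLR h4
      linarith
    have i2 : r' * (-1) ≤ r' * (R - |L|) :=
      mul_le_mul_of_nonneg_left (by linarith [neg_abs_le R]) h2
    have i3 : r * (-1) ≤ r * (-R - |L|) :=
      mul_le_mul_of_nonneg_left (by linarith [le_abs_self R]) h1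
    have i4 := mul_le_mul_of_nonneg_left i1 h3
    linarith
  · have i1 : 0 ≤ b * g * (|L| - q * L) := mul_nonneg (mul_nonneg h3 h4) (by linarith)
    have i2 : 0 ≤ b * |R| * (γ - g) := mul_nonneg (mul_nonneg h3 aR) (by linarith)
    have hr : r' = 1 - b - r := by linarith
    subst hr
    linarith

/-- The parameters of the learner: the probability `δ` of the uniform exploration, the learning rate
`η` for the first square, the rate `γ` of the exploration of the first square, and the threshold
`K` beyond which the estimated total imbalance of the second square is trusted. -/
structure Tuning where
  δ : ℝ
  η : ℝ
  γ : ℝ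
  K : ℝ
  δ_pos : 0 < δ
  δ_le : δ ≤ 1 / 10
  η_pos : 0 < η
  η_le : 2 * η ≤ δ
  γ_pos : 0 < γ
  γ_le : γ ≤ 1
  K_pos : 0 < K

namespace Tuning

variable (T : Tuning)

/-- The weight of playing (and exploring) the sign of the first square, as a function of the estimated
total imbalance `v` of the second square; the rest of the weight is on the sign of `v`. -/
noncomputable def base (v : ℝ) : ℝ := 1 - (ramp T.K v + ramp T.K (-v))

/-- The slope of the potential at the estimated total imbalance `u` of the first square. -/
noncomputable def slope (u : ℝ) : ℝ := Real.tanh (T.η * u)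

/-- The rate of exploration of the first square. -/
noncomputable def rate (u : ℝ) : ℝ := T.γ * (1 - T.slope u ^ 2)

/-- The mean sign that is played on the first square. It exceeds `slope` in modulus just enough to
make up for the rounds in which that square is explored; it stays in `[-1, 1]` because the rate of
exploration vanishes where `slope` is near `1` or `-1`. -/
noncomputable def bias (u : ℝ) : ℝ := T.slope u / (1 - T.rate u / 2)

/-- The distribution of the action, when the estimated total imbalances are `s.1` and `s.2`. -/
noncomputable def policy (s : ℝ × ℝ) : Fin 9 → ℝ :=
  ![(1 - 5 * T.δ) * ramp T.K (-s.2), (1 - 5 * T.δ) * ramp T.K s.2,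
    (1 - 5 * T.δ) * (T.base s.2 * ((1 - T.rate s.1) * ((1 - T.bias s.1) / 2))),
    (1 - 5 * T.δ) * (T.base s.2 * ((1 - T.rate s.1) * ((1 + T.bias s.1) / 2))),
    T.δ + (1 - 5 * T.δ) * (T.base s.2 * (T.rate s.1 / 3)),
    T.δ + (1 - 5 * T.δ) * (T.base s.2 * (T.rate s.1 / 3)),
    T.δ + (1 - 5 * T.δ) * (T.base s.2 * (T.rate s.1 / 3)), T.δ, T.δ]

lemma base_nonneg (v : ℝ) : 0 ≤ T.base v := by
  have := ramp_add_ramp_neg_le_one T.K_pos v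
  rw [base]; linarith

lemma base_le_one (v : ℝ) : T.base v ≤ 1 := by
  have h1 := ramp_nonneg T.K_pos v
  have h2 := ramp_nonneg T.K_pos (-v)
  rw [base]; linarith

lemma abs_slope_lt_one (u : ℝ) : |T.slope u| < 1 := Real.abs_tanh_lt_one _

lemma slope_sq_lt_one (u : ℝ) : T.slope u ^ 2 < 1 := Real.tanh_sq_lt_one _

lemma rate_pos (u : ℝ) : 0 < T.rate u := mul_pos T.γ_pos (sub_pos.2 (T.slope_sq_lt_one u))

lemma rate_le (u : ℝ) : T.rate u ≤ T.γ :=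
  mul_le_of_le_one_right T.γ_pos.le (by linarith [sq_nonneg (T.slope u)])

lemma rate_le_one (u : ℝ) : T.rate u ≤ 1 := (T.rate_le u).trans T.γ_le

lemma bias_mul (u : ℝ) : T.bias u * (1 - T.rate u / 2) = T.slope u :=
  div_mul_cancel₀ _ (by linarith [T.rate_le_one u])

lemma abs_bias_le_one (u : ℝ) : |T.bias u| ≤ 1 := by
  have h1 := T.rate_le_one u
  have h2 := T.abs_slope_lt_one u
  rw [bias, abs_div, abs_of_pos (by linarith : 0 < 1 - T.rate u / 2), div_le_one (by linarith)]
  have h3 : T.rate u ≤ 1 * (1 - |T.slope u| ^ 2) := by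
    rw [sq_abs]
    exact mul_le_mul_of_nonneg_right T.γ_le (by linarith [T.slope_sq_lt_one u])
  nlinarith [abs_nonneg (T.slope u)]

lemma policy_mem (s : ℝ × ℝ) : T.policy s ∈ stdSimplex ℝ (Fin 9) := by
  have h1 := ramp_nonneg T.K_pos s.2
  have h2 := ramp_nonneg T.K_pos (-s.2)
  have h3 := T.base_nonneg s.2
  have h4 := T.rate_pos s.1
  have h5 := T.rate_le_one s.1
  have h6 := abs_le.1 (T.abs_bias_le_one s.1)
  have h7 := T.δ_pos
  have h8 := T.δ_le
  have h9 : 0 ≤ 1 - 5 * T.δ := by linarith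
  have h10 : 0 ≤ (1 - T.bias s.1) / 2 := by linarith
  have h11 : 0 ≤ (1 + T.bias s.1) / 2 := by linarith
  have h12 : 0 ≤ 1 - T.rate s.1 := by linarith
  refine ⟨fun a => ?_, ?_⟩
  · fin_cases a <;> simp [policy] <;> positivity
  · simp only [policy, Fin.sum_univ_succ]
    simp
    rw [base]
    ring

/-- The mean loss of a round. Inside each square the loss is controlled by a linear function of the
imbalance; only the cost of the uniform exploration and a fraction `γ / 2` of `|devR x|` are lost. -/
lemma sum_policy_mul_gap_le (s : ℝ × ℝ) {x : Fin 8 → ℝ} (hx : x ∈ stdSimplex ℝ (Fin 8)) :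
    ∑ a, T.policy s a * gap a x
      ≤ 13 * T.δ - (T.base s.2 * T.slope s.1 * devL x + (1 - T.base s.2) * |devL x|)
        - ((1 - T.γ / 2) * T.base s.2 * |devR x|
          + (ramp T.K s.2 - ramp T.K (-s.2)) * devR x) := by
  have e : ∑ a, T.policy s a * gap a x
      = (1 - 5 * T.δ) * (ramp T.K (-s.2) * (devR x - |devL x|)
          + ramp T.K s.2 * (-devR x - |devL x|)
          + T.base s.2 * ((1 - T.rate s.1) * (-T.bias s.1 * devL x - |devR x|)
            - T.rate s.1 * (|devL x| + |devR x|) / 2))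
        + T.δ * (-3 / 2 * (|devL x| + |devR x|) + 4 * (2 - mid x)) := by
    simp only [policy, gap, Fin.sum_univ_succ]
    simp
    ring
  have h7 := T.δ_pos
  have hm := mid_mem hx
  have hc := mixture_bounds (ramp_nonneg T.K_pos s.2) (ramp_nonneg T.K_pos (-s.2))
    (T.base_nonneg s.2) rfl (T.rate_pos s.1).le (T.rate_le_one s.1) (T.rate_le s.1)
    (T.abs_bias_le_one s.1) (abs_dev_le hx)
  rw [T.bias_mul] at hc
  have i1 := mul_le_mul_of_nonneg_left hc.1 h7.le
  have i2 : T.δ * (-3 / 2 * (|devL x| + |devR x|) + 4 * (2 - mid x)) ≤ T.δ * 8 :=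
    mul_le_mul_of_nonneg_left (by linarith [abs_nonneg (devL x), abs_nonneg (devR x)]) h7.le
  rw [e, sub_mul, one_mul, mul_assoc 5]
  linarith [hc.2]

/-- The importance-weighted estimate of `∑ a, i a * ℙ(signal of a = 1)`. -/
noncomputable def estimate (i : Fin 9 → ℝ) (s : ℝ × ℝ) (o : Fin 9 × Fin 2) : ℝ :=
  i o.1 * ((o.2 : ℕ) : ℝ) / T.policy s o.1

/-- The combination of signal probabilities that equals `devL`. -/
def signL : Fin 9 → ℝ := ![0, 0, 0, 0, 1, 1, -1, 0, 0]

/-- The combination of signal probabilities that equals `devR + 1`. -/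
def signR : Fin 9 → ℝ := ![0, 0, 0, 0, 0, 0, 1, 1, 1]

/-- The mean of `F` over the action and signal of a round. -/
noncomputable def roundMean (x : Fin 8 → ℝ) (s : ℝ × ℝ) (F : Fin 9 × Fin 2 → ℝ) : ℝ :=
  ∑ o, T.policy s o.1 * (exoticGame 1).signalLaw o.1 x o.2 * F o

section RoundMean

variable {T} {x : Fin 8 → ℝ} {s : ℝ × ℝ}

lemma roundMean_mono (hx : x ∈ stdSimplex ℝ (Fin 8)) {F F' : Fin 9 × Fin 2 → ℝ}
    (h : ∀ o, F o ≤ F' o) : T.roundMean x s F ≤ T.roundMean x s F' :=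
  Finset.sum_le_sum fun o _ => mul_le_mul_of_nonneg_left (h o)
    (mul_nonneg ((T.policy_mem s).1 _) ((exoticGame 1).signalLaw_nonneg hx _ _))

lemma roundMean_add (F F' : Fin 9 × Fin 2 → ℝ) :
    T.roundMean x s (fun o => F o + F' o) = T.roundMean x s F + T.roundMean x s F' := by
  simp only [roundMean, mul_add, Finset.sum_add_distrib]

lemma roundMean_mul (r : ℝ) (F : Fin 9 × Fin 2 → ℝ) :
    T.roundMean x s (fun o => r * F o) = r * T.roundMean x s F := by
  simp only [roundMean, Finset.mul_sum]
  exact Finset.sum_congr rfl fun o _ => by ring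

lemma signalLaw_zero_add_one (hx : x ∈ stdSimplex ℝ (Fin 8)) (a : Fin 9) :
    (exoticGame 1).signalLaw a x 0 + (exoticGame 1).signalLaw a x 1 = 1 := by
  rw [signalLaw_zero, hx.2]; ring

lemma roundMean_const (hx : x ∈ stdSimplex ℝ (Fin 8)) (r : ℝ) :
    T.roundMean x s (fun _ => r) = r := by
  rw [roundMean, Fintype.sum_prod_type]
  simp only [Fin.sum_univ_two, ← add_mul, ← mul_add, signalLaw_zero_add_one hx, mul_one]
  rw [← Finset.sum_mul, (T.policy_mem s).2, one_mul]

lemma le_policy (s : ℝ × ℝ) {a : Fin 9} (ha : 4 ≤ a) : T.δ ≤ T.policy s a := by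
  have h3 := T.base_nonneg s.2
  have h4 := T.rate_pos s.1
  have h9 : 0 ≤ 1 - 5 * T.δ := by linarith [T.δ_le]
  have : 0 ≤ (1 - 5 * T.δ) * (T.base s.2 * (T.rate s.1 / 3)) := by positivity
  fin_cases a <;> simp [policy] at ha ⊢ <;> linarith

lemma base_mul_rate_le_policy (s : ℝ × ℝ) {a : Fin 9} (ha : 4 ≤ a) (ha' : a ≤ 6) :
    T.base s.2 * T.rate s.1 ≤ 6 * T.policy s a := by
  have h3 := T.base_nonneg s.2
  have h4 := T.rate_pos s.1
  have h7 := T.δ_pos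
  have h9 : 1 / 2 ≤ 1 - 5 * T.δ := by linarith [T.δ_le]
  have : 1 / 2 * (T.base s.2 * (T.rate s.1 / 3))
      ≤ (1 - 5 * T.δ) * (T.base s.2 * (T.rate s.1 / 3)) :=
    mul_le_mul_of_nonneg_right h9 (by positivity)
  fin_cases a <;> simp [policy] at ha ha' ⊢ <;> linarith

lemma roundMean_estimate (s : ℝ × ℝ) {i : Fin 9 → ℝ} (hi : ∀ a, i a ≠ 0 → 4 ≤ a) :
    T.roundMean x s (T.estimate i s) = ∑ a, i a * (exoticGame 1).signalLaw a x 1 := by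
  rw [roundMean, Fintype.sum_prod_type]
  refine Finset.sum_congr rfl fun a _ => ?_
  rcases eq_or_ne (i a) 0 with h | h
  · simp [estimate, h]
  · have := (T.δ_pos.trans_le (le_policy s (hi a h))).ne'
    simp [estimate, Fin.sum_univ_two]
    field_simp

lemma roundMean_estimate_sq (s : ℝ × ℝ) {i : Fin 9 → ℝ} (hi : ∀ a, i a ≠ 0 → 4 ≤ a) :
    T.roundMean x s (fun o => T.estimate i s o ^ 2)
      = ∑ a, i a ^ 2 * (exoticGame 1).signalLaw a x 1 / T.policy s a := by
  rw [roundMean, Fintype.sum_prod_type]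
  refine Finset.sum_congr rfl fun a _ => ?_
  rcases eq_or_ne (i a) 0 with h | h
  · simp [estimate, h]
  · have := (T.δ_pos.trans_le (le_policy s (hi a h))).ne'
    simp [estimate, Fin.sum_univ_two]
    field_simp

lemma signL_ne_zero (a : Fin 9) (h : signL a ≠ 0) : 4 ≤ a ∧ a ≤ 6 := by
  fin_cases a <;> simp [signL] at h ⊢

lemma signR_ne_zero (a : Fin 9) (h : signR a ≠ 0) : 4 ≤ a := by
  fin_cases a <;> simp [signR] at h ⊢

lemma signalLaw_le_one (hx : x ∈ stdSimplex ℝ (Fin 8)) (a : Fin 9) :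
    (exoticGame 1).signalLaw a x 1 ≤ 1 := by
  linarith [signalLaw_zero_add_one hx a, (exoticGame 1).signalLaw_nonneg hx a 0]

lemma roundMean_estimate_signL (s : ℝ × ℝ) :
    T.roundMean x s (T.estimate signL s) = devL x := by
  rw [roundMean_estimate s fun a h => (signL_ne_zero a h).1]
  simp only [signalLaw_one, Fin.sum_univ_succ]
  simp [signL, devL]
  ring

lemma roundMean_estimate_signR (hx : x ∈ stdSimplex ℝ (Fin 8)) (s : ℝ × ℝ) :
    T.roundMean x s (fun o => T.estimate signR s o - 1) = devR x := by
  have h : ∀ o, T.estimate signR s o - 1 = T.estimate signR s o + -1 := fun o => by ring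
  simp_rw [h]
  rw [roundMean_add, roundMean_const hx, roundMean_estimate s signR_ne_zero]
  have := hx.2
  simp only [signalLaw_one, Fin.sum_univ_succ] at this ⊢
  simp at this
  simp [signR, devR]
  linarith

/-- The variance of the estimate for the first square is inversely proportional to its rate of
exploration. -/
lemma base_sq_mul_roundMean_estimate_signL_sq_le (hx : x ∈ stdSimplex ℝ (Fin 8)) (s : ℝ × ℝ) :
    T.base s.2 ^ 2 * T.roundMean x s (fun o => T.estimate signL s o ^ 2) ≤ 18 / T.rate s.1 := by
  have hr := T.rate_pos s.1
  rw [roundMean_estimate_sq s fun a h => (signL_ne_zero a h).1, Finset.mul_sum]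
  have h : ∀ a, T.base s.2 ^ 2 * (signL a ^ 2 * (exoticGame 1).signalLaw a x 1 / T.policy s a)
      ≤ signL a ^ 2 * (6 / T.rate s.1) := by
    intro a
    rcases eq_or_ne (signL a) 0 with h | h
    · simp [h]
    obtain ⟨h4, h6⟩ := signL_ne_zero a h
    have hp := T.δ_pos.trans_le (le_policy s h4)
    have h1 := base_mul_rate_le_policy (T := T) s h4 h6
    have h2 := T.base_nonneg s.2
    have h3 := T.base_le_one s.2
    have h5 : T.base s.2 ^ 2 * (exoticGame 1).signalLaw a x 1 / T.policy s a ≤ 6 / T.rate s.1 := by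
      rw [div_le_div_iff₀ hp hr]
      have h7 := signalLaw_le_one hx a
      have h8 := (exoticGame 1).signalLaw_nonneg hx a 1
      calc T.base s.2 ^ 2 * (exoticGame 1).signalLaw a x 1 * T.rate s.1
          = T.base s.2 * (exoticGame 1).signalLaw a x 1 * (T.base s.2 * T.rate s.1) := by ring
        _ ≤ 1 * (T.base s.2 * T.rate s.1) :=
            mul_le_mul_of_nonneg_right (mul_le_one₀ h3 h8 h7) (by positivity)
        _ ≤ _ := by linarith
    calc _ = signL a ^ 2 * (T.base s.2 ^ 2 * (exoticGame 1).signalLaw a x 1 / T.policy s a) := by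
          ring
      _ ≤ _ := mul_le_mul_of_nonneg_left h5 (sq_nonneg _)
  refine (Finset.sum_le_sum fun a _ => h a).trans (le_of_eq ?_)
  simp [Fin.sum_univ_succ, signL]
  ring

lemma roundMean_estimate_signR_sq_le (hx : x ∈ stdSimplex ℝ (Fin 8)) (s : ℝ × ℝ) :
    T.roundMean x s (fun o => (T.estimate signR s o - 1) ^ 2) ≤ 4 / T.δ := by
  have h1 : T.roundMean x s (fun o => T.estimate signR s o ^ 2) ≤ 3 / T.δ := by
    rw [roundMean_estimate_sq s signR_ne_zero]
    have h : ∀ a, signR a ^ 2 * (exoticGame 1).signalLaw a x 1 / T.policy s a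
        ≤ signR a ^ 2 * (1 / T.δ) := by
      intro a
      rcases eq_or_ne (signR a) 0 with h | h
      · simp [h]
      rw [mul_div_assoc]
      exact mul_le_mul_of_nonneg_left (div_le_div₀ zero_le_one (signalLaw_le_one hx a) T.δ_pos
        (le_policy s (signR_ne_zero a h))) (sq_nonneg _)
    refine (Finset.sum_le_sum fun a _ => h a).trans (le_of_eq ?_)
    simp [Fin.sum_univ_succ, signR]
    ring
  have h2 : ∀ o, (T.estimate signR s o - 1) ^ 2 ≤ T.estimate signR s o ^ 2 + 1 := fun o => by
    have : 0 ≤ T.estimate signR s o := by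
      refine div_nonneg (mul_nonneg ?_ (by positivity)) ((T.policy_mem s).1 _)
      have : ∀ a, 0 ≤ signR a := fun a => by fin_cases a <;> simp [signR]
      exact this _
    nlinarith
  refine (roundMean_mono hx h2).trans ?_
  rw [roundMean_add, roundMean_const hx]
  have : 1 ≤ 1 / T.δ := by
    rw [le_div_iff₀ T.δ_pos]; linarith [T.δ_le]
  have e : 4 / T.δ = 3 / T.δ + 1 / T.δ := by ring
  linarith

lemma abs_estimate_le (s : ℝ × ℝ) {i : Fin 9 → ℝ} (hi : ∀ a, i a ≠ 0 → 4 ≤ a)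
    (hi1 : ∀ a, |i a| ≤ 1) (o : Fin 9 × Fin 2) : |T.estimate i s o| ≤ 1 / T.δ := by
  rcases eq_or_ne (i o.1) 0 with h | h
  · simp [estimate, h, T.δ_pos.le]
  have hp := le_policy (T := T) s (hi _ h)
  rw [estimate, abs_div, abs_mul, abs_of_pos (T.δ_pos.trans_le hp)]
  refine div_le_div₀ zero_le_one (mul_le_one₀ (hi1 _) (abs_nonneg _) ?_) T.δ_pos hp
  rw [Nat.abs_cast]
  exact_mod_cast Nat.lt_succ_iff.1 o.2.isLt

lemma abs_signL_le (a : Fin 9) : |signL a| ≤ 1 := by fin_cases a <;> simp [signL]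

lemma abs_signR_le (a : Fin 9) : |signR a| ≤ 1 := by fin_cases a <;> simp [signR]

/-- The potential of the first square grows by its slope times the mean increment, up to a constant:
the exploration is concentrated where the potential is curved. -/
lemma roundMean_coshPotential_le (hx : x ∈ stdSimplex ℝ (Fin 8)) (s : ℝ × ℝ) :
    T.roundMean x s (fun o => coshPotential T.η (s.1 + T.base s.2 * T.estimate signL s o))
      ≤ coshPotential T.η s.1 + T.base s.2 * T.slope s.1 * devL x + 36 * T.η / T.γ := by
  have hb := T.base_nonneg s.2
  have hb' := T.base_le_one s.2
  have h1 : ∀ o, coshPotential T.η (s.1 + T.base s.2 * T.estimate signL s o)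
      ≤ (coshPotential T.η s.1 + T.slope s.1 * T.base s.2 * T.estimate signL s o)
        + 2 * T.η * (1 - T.slope s.1 ^ 2) * T.base s.2 ^ 2 * T.estimate signL s o ^ 2 := by
    intro o
    refine (coshPotential_add_le T.η_pos ?_).trans (le_of_eq ?_)
    · have h2 := abs_estimate_le (T := T) s (fun a h => (signL_ne_zero a h).1) abs_signL_le o
      rw [abs_mul, abs_mul, abs_of_pos T.η_pos, abs_of_nonneg hb]
      have h3 : T.base s.2 * |T.estimate signL s o| ≤ 1 / T.δ :=
        (mul_le_of_le_one_left (abs_nonneg _) hb').trans h2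
      calc T.η * (T.base s.2 * |T.estimate signL s o|) ≤ T.η * (1 / T.δ) :=
            mul_le_mul_of_nonneg_left h3 T.η_pos.le
        _ ≤ 1 / 2 := by
            rw [mul_one_div, div_le_iff₀ T.δ_pos]; linarith [T.η_le]
    · rw [← slope]; ring
  refine (roundMean_mono hx h1).trans ?_
  rw [roundMean_add, roundMean_add, roundMean_const hx, roundMean_mul, roundMean_mul,
    roundMean_estimate_signL]
  have h2 := base_sq_mul_roundMean_estimate_signL_sq_le (T := T) hx s
  have h3 : 0 < 1 - T.slope s.1 ^ 2 := sub_pos.2 (T.slope_sq_lt_one _)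
  have h4 := mul_le_mul_of_nonneg_left h2 (mul_nonneg (mul_nonneg two_pos.le T.η_pos.le) h3.le)
  have h5 : 2 * T.η * (1 - T.slope s.1 ^ 2) * (18 / T.rate s.1) = 36 * T.η / T.γ := by
    have := T.γ_pos
    rw [rate]
    field_simp
    ring
  linarith

lemma roundMean_evenRampPotential_le (hx : x ∈ stdSimplex ℝ (Fin 8)) (s : ℝ × ℝ) :
    T.roundMean x s (fun o => evenRampPotential T.K (s.2 + (T.estimate signR s o - 1)))
      ≤ evenRampPotential T.K s.2 + (ramp T.K s.2 - ramp T.K (-s.2)) * devR x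
        + 4 / (T.δ * T.K) := by
  have hK := T.K_pos
  refine (roundMean_mono hx fun o => evenRampPotential_add_le hK _ _).trans ?_
  have h : ∀ o, (T.estimate signR s o - 1) ^ 2 / T.K = 1 / T.K * (T.estimate signR s o - 1) ^ 2 :=
    fun o => by ring
  simp_rw [h]
  rw [roundMean_add, roundMean_add, roundMean_const hx, roundMean_mul, roundMean_mul,
    roundMean_estimate_signR hx]
  have h2 := mul_le_mul_of_nonneg_left (roundMean_estimate_signR_sq_le (T := T) hx s)
    (one_div_pos.2 hK).le
  have h3 : 1 / T.K * (4 / T.δ) = 4 / (T.δ * T.K) := by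
    have := T.δ_pos
    field_simp
  linarith

/-- An exponential moment of the error of the estimate for the second square. -/
lemma roundMean_exp_le (hx : x ∈ stdSimplex ℝ (Fin 8)) (s : ℝ × ℝ) {l : ℝ}
    (hl : 2 * |l| ≤ T.δ) :
    T.roundMean x s (fun o => Real.exp (l * (T.estimate signR s o - 1 - devR x)))
      ≤ Real.exp (4 * l ^ 2 / T.δ) := by
  have hδ := T.δ_pos
  have hd : |devR x| ≤ 1 := by linarith [abs_dev_le hx, abs_nonneg (devL x)]
  have h1 : ∀ o, Real.exp (l * (T.estimate signR s o - 1 - devR x))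
      ≤ (1 + l ^ 2 * devR x ^ 2 - l * devR x)
        + (l - 2 * l ^ 2 * devR x) * (T.estimate signR s o - 1)
        + l ^ 2 * (T.estimate signR s o - 1) ^ 2 := by
    intro o
    have h2 : |l * (T.estimate signR s o - 1 - devR x)| ≤ 1 := by
      have h3 := abs_estimate_le (T := T) s signR_ne_zero abs_signR_le o
      have h4 : |T.estimate signR s o - 1 - devR x| ≤ 1 / T.δ + 2 := by
        rw [abs_le] at h3 hd ⊢
        constructor <;> linarith
      have h5 : 1 / T.δ + 2 ≤ 2 / T.δ := by
        rw [div_add' _ _ _ hδ.ne', div_le_div_iff_of_pos_right hδ]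
        linarith [T.δ_le]
      rw [abs_mul]
      calc |l| * |T.estimate signR s o - 1 - devR x| ≤ |l| * (2 / T.δ) :=
            mul_le_mul_of_nonneg_left (h4.trans h5) (abs_nonneg _)
        _ = 2 * |l| / T.δ := by ring
        _ ≤ 1 := (div_le_one hδ).2 hl
    have := (abs_le.1 (Real.abs_exp_sub_one_sub_id_le h2)).2
    linarith
  refine (roundMean_mono hx h1).trans ?_
  rw [roundMean_add, roundMean_add, roundMean_const hx, roundMean_mul, roundMean_mul,
    roundMean_estimate_signR hx]
  have h2 := mul_le_mul_of_nonneg_left (roundMean_estimate_signR_sq_le (T := T) hx s) (sq_nonneg l)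
  have h3 := Real.add_one_le_exp (4 * l ^ 2 / T.δ)
  have h4 : l ^ 2 * (4 / T.δ) = 4 * l ^ 2 / T.δ := by ring
  have h5 : 0 ≤ l ^ 2 * devR x ^ 2 := by positivity
  linarith

end RoundMean

end Tuning

/-! ### The upper bound -/

namespace Tuning

variable (T : Tuning)

/-- The estimated total imbalances after an observation. That of the first square only counts the
share `base` of each round. -/
noncomputable def update (s : ℝ × ℝ) (o : Fin 9 × Fin 2) : ℝ × ℝ :=
  (s.1 + T.base s.2 * T.estimate signL s o, s.2 + (T.estimate signR s o - 1))

/-- The estimated total imbalances after a history. -/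
noncomputable def stateOf : (t : ℕ) → (Fin t → Fin 9 × Fin 2) → ℝ × ℝ
  | 0, _ => (0, 0)
  | t + 1, h => T.update (stateOf t (Fin.init h)) (h (Fin.last t))

/-- The learner that plays `policy` at the estimated total imbalances. -/
noncomputable def learner : Learner (Fin 9) (Fin 2) :=
  fun t h => ⟨T.policy (T.stateOf t h), T.policy_mem _⟩

/-- The mean of a function of the estimated total imbalances before round `t`. -/
noncomputable def runMean (x : ℕ → stdSimplex ℝ (Fin 8)) (t : ℕ) (Φ : ℝ × ℝ → ℝ) : ℝ :=
  expect ((exoticGame 1).obsKernel T.learner x) t fun h => Φ (T.stateOf t h)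

variable {T} {x : ℕ → stdSimplex ℝ (Fin 8)}

lemma runMean_zero (Φ : ℝ × ℝ → ℝ) : T.runMean x 0 Φ = Φ (0, 0) := by
  rw [runMean, expect_zero]; rfl

lemma runMean_succ (t : ℕ) (Φ : ℝ × ℝ → ℝ) :
    T.runMean x (t + 1) Φ
      = T.runMean x t fun s => T.roundMean (x t) s fun o => Φ (T.update s o) := by
  rw [runMean, expect_succ, runMean]
  congr 1
  funext h
  refine Finset.sum_congr rfl fun o _ => ?_
  simp only [stateOf, Fin.init_snoc, Fin.snoc_last]
  rfl

lemma runMean_mono {t : ℕ} {Φ Ψ : ℝ × ℝ → ℝ} (h : ∀ s, Φ s ≤ Ψ s) :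
    T.runMean x t Φ ≤ T.runMean x t Ψ :=
  expect_mono (Game.obsKernel_nonneg _ _ _) fun _ => h _

lemma runMean_add (t : ℕ) (Φ Ψ : ℝ × ℝ → ℝ) :
    T.runMean x t (fun s => Φ s + Ψ s) = T.runMean x t Φ + T.runMean x t Ψ :=
  expect_add _ _ _

lemma runMean_sub (t : ℕ) (Φ Ψ : ℝ × ℝ → ℝ) :
    T.runMean x t (fun s => Φ s - Ψ s) = T.runMean x t Φ - T.runMean x t Ψ :=
  expect_sub _ _ _

lemma runMean_const_mul (t : ℕ) (r : ℝ) (Φ : ℝ × ℝ → ℝ) :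
    T.runMean x t (fun s => r * Φ s) = r * T.runMean x t Φ :=
  expect_const_mul _ _ _

lemma runMean_const (t : ℕ) (r : ℝ) : T.runMean x t (fun _ => r) = r :=
  expect_const (Game.sum_obsKernel _ _ _) _ _

lemma runMean_mul_const (t : ℕ) (r : ℝ) (Φ : ℝ × ℝ → ℝ) :
    T.runMean x t (fun s => Φ s * r) = T.runMean x t Φ * r := by
  simp_rw [mul_comm _ r]
  exact runMean_const_mul _ _ _

lemma abs_runMean_le (t : ℕ) (Φ : ℝ × ℝ → ℝ) :
    |T.runMean x t Φ| ≤ T.runMean x t fun s => |Φ s| :=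
  abs_expect_le (Game.obsKernel_nonneg _ _ _) _

/-- A potential whose mean drift in round `t` is at most `B t` is at most the sum of the means of
the `B t`. -/
lemma runMean_le_sum {Φ : ℝ × ℝ → ℝ} {B : ℕ → ℝ × ℝ → ℝ} (h0 : Φ (0, 0) = 0)
    (h : ∀ t s, T.roundMean (x t) s (fun o => Φ (T.update s o)) ≤ Φ s + B t s) (n : ℕ) :
    T.runMean x n Φ ≤ ∑ t ∈ range n, T.runMean x t (B t) := by
  induction n with
  | zero => simp [runMean_zero, h0]
  | succ n ih =>
    rw [Finset.sum_range_succ, runMean_succ]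
    refine (runMean_mono (h n)).trans ?_
    rw [runMean_add]
    linarith

lemma runMean_fst (n : ℕ) :
    T.runMean x n Prod.fst = ∑ t ∈ range n, T.runMean x t (fun s => T.base s.2) * devL (x t) := by
  induction n with
  | zero => simp [runMean_zero]
  | succ n ih =>
    rw [Finset.sum_range_succ, runMean_succ, ← ih, ← runMean_mul_const, ← runMean_add]
    congr 1
    funext s
    simp only [update]
    rw [roundMean_add, roundMean_const (coe_mem_stdSimplex _), roundMean_mul,
      roundMean_estimate_signL]

lemma runMean_snd (n : ℕ) : T.runMean x n Prod.snd = ∑ t ∈ range n, devR (x t) := by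
  induction n with
  | zero => simp [runMean_zero]
  | succ n ih =>
    rw [Finset.sum_range_succ, runMean_succ, ← ih,
      ← runMean_const (T := T) (x := x) n (devR (x n)), ← runMean_add]
    congr 1
    funext s
    simp only [update]
    rw [roundMean_add, roundMean_const (coe_mem_stdSimplex _),
      roundMean_estimate_signR (coe_mem_stdSimplex _)]

/-- The share of the first square in the regret. -/
lemma abs_sum_devL_le (n : ℕ) :
    |∑ t ∈ range n, devL (x t)|
      ≤ ∑ t ∈ range n, T.runMean x t (fun s => T.base s.2 * T.slope s.1 * devL (x t)
          + (1 - T.base s.2) * |devL (x t)|)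
        + (Real.log 2 / T.η + n * (36 * T.η / T.γ)) := by
  have h1 := runMean_le_sum (T := T) (x := x) (Φ := fun s => coshPotential T.η s.1)
    (B := fun t s => T.base s.2 * T.slope s.1 * devL (x t) + 36 * T.η / T.γ)
    (by simp [coshPotential])
    (fun t s => by
      have := roundMean_coshPotential_le (T := T) (coe_mem_stdSimplex (x t)) s
      simp only [update]
      linarith) n
  have h2 : |T.runMean x n Prod.fst| - Real.log 2 / T.η
      ≤ T.runMean x n fun s => coshPotential T.η s.1 := by
    calc |T.runMean x n Prod.fst| - Real.log 2 / T.η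
        ≤ T.runMean x n (fun s => |s.1|) - T.runMean x n (fun _ => Real.log 2 / T.η) := by
          rw [runMean_const]; linarith [abs_runMean_le (T := T) (x := x) n Prod.fst]
      _ = T.runMean x n fun s => |s.1| - Real.log 2 / T.η := (runMean_sub _ _ _).symm
      _ ≤ _ := runMean_mono fun s => abs_sub_le_coshPotential T.η_pos s.1
  have h3 : |∑ t ∈ range n, T.runMean x t (fun s => 1 - T.base s.2) * devL (x t)|
      ≤ ∑ t ∈ range n, T.runMean x t (fun s => (1 - T.base s.2) * |devL (x t)|) := by
    refine (Finset.abs_sum_le_sum_abs _ _).trans (Finset.sum_le_sum fun t _ => ?_)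
    rw [runMean_mul_const, abs_mul, abs_of_nonneg]
    have := runMean_mono (T := T) (x := x) (t := t) (Φ := fun _ => 0)
      (Ψ := fun s => 1 - T.base s.2) fun s => by linarith [T.base_le_one s.2]
    rwa [runMean_const] at this
  have h4 : ∑ t ∈ range n, devL (x t)
      = T.runMean x n Prod.fst
        + ∑ t ∈ range n, T.runMean x t (fun s => 1 - T.base s.2) * devL (x t) := by
    rw [runMean_fst, ← Finset.sum_add_distrib]
    refine Finset.sum_congr rfl fun t _ => ?_
    rw [runMean_sub, runMean_const]
    ring
  have h5 := abs_add_le (T.runMean x n Prod.fst)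
    (∑ t ∈ range n, T.runMean x t (fun s => 1 - T.base s.2) * devL (x t))
  rw [← h4] at h5
  simp only [runMean_add, runMean_const, Finset.sum_add_distrib, Finset.sum_const, card_range,
    nsmul_eq_mul] at h1 ⊢
  linarith

/-- An exponential moment of the error of the estimated total imbalance of the second square. -/
lemma runMean_exp_le {l : ℝ} (hl : 2 * |l| ≤ T.δ) (t : ℕ) :
    T.runMean x t (fun s => Real.exp (l * (s.2 - ∑ i ∈ range t, devR (x i))))
      ≤ Real.exp (t * (4 * l ^ 2 / T.δ)) := by
  induction t with
  | zero => simp [runMean_zero]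
  | succ t ih =>
    rw [runMean_succ, Finset.sum_range_succ]
    have h : ∀ s, T.roundMean (x t) s (fun o => Real.exp
          (l * ((T.update s o).2 - (∑ i ∈ range t, devR (x i) + devR (x t)))))
        ≤ Real.exp (4 * l ^ 2 / T.δ) * Real.exp (l * (s.2 - ∑ i ∈ range t, devR (x i))) := by
      intro s
      have e : ∀ o, Real.exp (l * ((T.update s o).2 - (∑ i ∈ range t, devR (x i) + devR (x t))))
          = Real.exp (l * (s.2 - ∑ i ∈ range t, devR (x i)))
            * Real.exp (l * (T.estimate signR s o - 1 - devR (x t))) := fun o => by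
        rw [← Real.exp_add, update]
        congr 1
        ring
      simp_rw [e]
      rw [roundMean_mul, mul_comm]
      exact mul_le_mul_of_nonneg_right (roundMean_exp_le (coe_mem_stdSimplex _) s hl)
        (Real.exp_pos _).le
    refine (runMean_mono h).trans ?_
    rw [runMean_const_mul]
    refine (mul_le_mul_of_nonneg_left ih (Real.exp_pos _).le).trans (le_of_eq ?_)
    rw [← Real.exp_add]
    congr 1
    push_cast
    ring

/-- The sign `1` or `-1` of a real number. -/
noncomputable def sgn (r : ℝ) : ℝ := if 0 ≤ r then 1 else -1

lemma abs_add_sub_abs_le (a b : ℝ) : |a + b| - |a| ≤ sgn (a + b) * b := by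
  rw [sgn]
  split_ifs with h
  · rw [abs_of_nonneg h]
    linarith [le_abs_self a]
  · rw [abs_of_neg (not_le.1 h)]
    linarith [neg_abs_le a]

lemma abs_sum_le_sum_sgn (d : ℕ → ℝ) (n : ℕ) :
    |∑ t ∈ range n, d t| ≤ ∑ t ∈ range n, sgn (∑ i ∈ range (t + 1), d i) * d t := by
  induction n with
  | zero => simp
  | succ n ih =>
    rw [Finset.sum_range_succ _ n, Finset.sum_range_succ _ n]
    have := abs_add_sub_abs_le (∑ t ∈ range n, d t) (d n)
    rw [← Finset.sum_range_succ] at this ⊢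
    linarith

/-- The learner relies on a wrong sign of the total imbalance `D` of the second square only where its
estimate `v` is far from `D`. -/
lemma wrong_sign_le {l v D d : ℝ} (hl : 0 ≤ l) (hd : |d| ≤ 1) :
    |(1 - T.base v) * sgn (D + d) - (ramp T.K v - ramp T.K (-v))|
      ≤ 2 * Real.exp (-(l * (T.K - 1))) * (Real.exp (l * (v - D)) + Real.exp (-l * (v - D))) := by
  have hK := T.K_pos
  have h1 := ramp_nonneg hK v
  have h2 := ramp_nonneg hK (-v)
  have h3 := ramp_le_one hK v
  have h4 := ramp_le_one hK (-v)
  rw [abs_le] at hd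
  have p1 := Real.exp_pos (-(l * (T.K - 1)))
  have p2 := Real.exp_pos (l * (v - D))
  have p3 := Real.exp_pos (-l * (v - D))
  have key : ∀ w, T.K - 1 ≤ w → 1 ≤ Real.exp (-(l * (T.K - 1))) * Real.exp (l * w) := by
    intro w hw
    rw [← Real.exp_add, Real.one_le_exp_iff]
    nlinarith
  rw [base, sgn]
  split_ifs with h
  · -- the sign is positive, so only the ramp on the negative side is wrong
    have e : (1 - (1 - (ramp T.K v + ramp T.K (-v)))) * 1 - (ramp T.K v - ramp T.K (-v))
        = 2 * ramp T.K (-v) := by ring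
    rw [e, abs_of_nonneg (by linarith)]
    rcases le_total (-v) T.K with hv | hv
    · rw [ramp_of_le hK hv, mul_zero]
      positivity
    · have := key (-(v - D)) (by linarith)
      rw [show l * -(v - D) = -l * (v - D) by ring] at this
      nlinarith [mul_pos p1 p2]
  · have e : (1 - (1 - (ramp T.K v + ramp T.K (-v)))) * -1 - (ramp T.K v - ramp T.K (-v))
        = -(2 * ramp T.K v) := by ring
    rw [e, abs_neg, abs_of_nonneg (by linarith)]
    rcases le_total v T.K with hv | hv
    · rw [ramp_of_le hK hv, mul_zero]
      positivity
    · have := key (v - D) (by linarith)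
      nlinarith [mul_pos p1 p3]

/-- The share of the second square in the regret. -/
lemma abs_sum_devR_le {l : ℝ} (hl0 : 0 ≤ l) (hl : 2 * l ≤ T.δ) (n : ℕ) :
    |∑ t ∈ range n, devR (x t)|
      ≤ ∑ t ∈ range n, T.runMean x t (fun s => (1 - T.γ / 2) * T.base s.2 * |devR (x t)|
          + (ramp T.K s.2 - ramp T.K (-s.2)) * devR (x t))
        + (n * (4 * Real.exp (n * (4 * l ^ 2 / T.δ) - l * (T.K - 1)))
          + T.γ / 2 * (3 / 2 * T.K + n * (4 / (T.δ * T.K)))) := by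
  have hγ := T.γ_pos
  have hγ' := T.γ_le
  have hδ := T.δ_pos
  have hdev : ∀ t, |devR (x t)| ≤ 1 := fun t => by
    linarith [abs_dev_le (coe_mem_stdSimplex (x t)), abs_nonneg (devL (x t))]
  set D : ℕ → ℝ := fun t => ∑ i ∈ range t, devR (x i) with hD
  have hDs : ∀ t, D (t + 1) = D t + devR (x t) := fun t => Finset.sum_range_succ _ _
  -- the drift of the even ramp potential
  have h1 := runMean_le_sum (T := T) (x := x) (Φ := fun s => evenRampPotential T.K s.2)
    (B := fun t s => (ramp T.K s.2 - ramp T.K (-s.2)) * devR (x t) + 4 / (T.δ * T.K))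
    (by simp [evenRampPotential, rampPotential_zero T.K_pos])
    (fun t s => by
      have := roundMean_evenRampPotential_le (T := T) (coe_mem_stdSimplex (x t)) s
      simp only [update]
      linarith) n
  have h2 : |D n| - 3 / 2 * T.K ≤ T.runMean x n fun s => evenRampPotential T.K s.2 := by
    calc |D n| - 3 / 2 * T.K
        ≤ T.runMean x n (fun s => |s.2|) - T.runMean x n (fun _ => 3 / 2 * T.K) := by
          rw [runMean_const, show D n = T.runMean x n Prod.snd from (runMean_snd n).symm]
          linarith [abs_runMean_le (T := T) (x := x) n Prod.snd]
      _ = T.runMean x n fun s => |s.2| - 3 / 2 * T.K := (runMean_sub _ _ _).symm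
      _ ≤ _ := runMean_mono fun s => abs_sub_le_evenRampPotential T.K_pos s.2
  simp only [runMean_add, runMean_const, Finset.sum_add_distrib, Finset.sum_const, card_range,
    nsmul_eq_mul] at h1
  -- one round
  have h3 : ∀ t ∈ range n, (1 - T.γ / 2) * (sgn (D (t + 1)) * devR (x t))
        + T.γ / 2 * T.runMean x t (fun s => (ramp T.K s.2 - ramp T.K (-s.2)) * devR (x t))
      ≤ T.runMean x t (fun s => (1 - T.γ / 2) * T.base s.2 * |devR (x t)|
          + (ramp T.K s.2 - ramp T.K (-s.2)) * devR (x t))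
        + 4 * Real.exp (n * (4 * l ^ 2 / T.δ) - l * (T.K - 1)) := by
    intro t ht
    have hexp : ∀ l' : ℝ, |l'| = l → T.runMean x t (fun s => Real.exp (l' * (s.2 - D t)))
        ≤ Real.exp (n * (4 * l ^ 2 / T.δ)) := by
      intro l' hl'
      refine (runMean_exp_le (by rw [hl']; exact hl) t).trans (Real.exp_le_exp.2 ?_)
      rw [← sq_abs l', hl']
      have : (t : ℝ) ≤ n := by exact_mod_cast (Finset.mem_range.1 ht).le
      exact mul_le_mul_of_nonneg_right this (by positivity)
    have e1 := hexp l (abs_of_nonneg hl0)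
    have e2 := hexp (-l) (by rw [abs_neg, abs_of_nonneg hl0])
    have hs : ∀ s : ℝ × ℝ, (1 - T.γ / 2) * (sgn (D (t + 1)) * devR (x t))
          + T.γ / 2 * ((ramp T.K s.2 - ramp T.K (-s.2)) * devR (x t))
        ≤ ((1 - T.γ / 2) * T.base s.2 * |devR (x t)|
            + (ramp T.K s.2 - ramp T.K (-s.2)) * devR (x t))
          + 2 * Real.exp (-(l * (T.K - 1)))
            * (Real.exp (l * (s.2 - D t)) + Real.exp (-l * (s.2 - D t))) := by
      intro s
      have w := wrong_sign_le (T := T) (v := s.2) (D := D t) hl0 (hdev t)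
      rw [← hDs] at w
      set W := (1 - T.base s.2) * sgn (D (t + 1)) - (ramp T.K s.2 - ramp T.K (-s.2)) with hW
      set E := 2 * Real.exp (-(l * (T.K - 1)))
            * (Real.exp (l * (s.2 - D t)) + Real.exp (-l * (s.2 - D t)))
      have w1 : W * devR (x t) ≤ E := by
        refine (le_abs_self _).trans ?_
        rw [abs_mul]
        exact (mul_le_of_le_one_right (abs_nonneg _) (hdev t)).trans w
      have w0 : 0 ≤ E := (abs_nonneg _).trans w
      have w2 : (1 - T.γ / 2) * (W * devR (x t)) ≤ E :=
        (mul_le_mul_of_nonneg_left w1 (by linarith)).trans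
          (mul_le_of_le_one_left w0 (by linarith))
      have w3 : sgn (D (t + 1)) * devR (x t) ≤ |devR (x t)| := by
        rw [sgn]
        split_ifs
        · rw [one_mul]; exact le_abs_self _
        · rw [neg_one_mul]; exact neg_le_abs _
      have w4 := mul_le_mul_of_nonneg_left w3
        (mul_nonneg (by linarith : 0 ≤ 1 - T.γ / 2) (T.base_nonneg s.2))
      rw [hW] at w2
      linarith
    have := runMean_mono (T := T) (x := x) (t := t) hs
    rw [runMean_add, runMean_const, runMean_const_mul, runMean_add t _ (fun s =>
      2 * Real.exp (-(l * (T.K - 1))) * (Real.exp (l * (s.2 - D t)) + Real.exp (-l * (s.2 - D t)))),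
      runMean_const_mul, runMean_add t (fun s => Real.exp (l * (s.2 - D t)))] at this
    refine this.trans (add_le_add le_rfl ?_)
    have e3 : 4 * Real.exp (n * (4 * l ^ 2 / T.δ) - l * (T.K - 1))
        = 2 * Real.exp (-(l * (T.K - 1))) * (Real.exp (n * (4 * l ^ 2 / T.δ))
          + Real.exp (n * (4 * l ^ 2 / T.δ))) := by
      rw [sub_eq_add_neg, Real.exp_add]
      ring
    rw [e3]
    exact mul_le_mul_of_nonneg_left (add_le_add e1 e2) (by positivity)
  have h4 := Finset.sum_le_sum h3
  rw [Finset.sum_add_distrib, ← Finset.mul_sum, ← Finset.mul_sum, Finset.sum_add_distrib,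
    Finset.sum_const, card_range, nsmul_eq_mul] at h4
  have h5 := abs_sum_le_sum_sgn (fun t => devR (x t)) n
  have h6 := mul_le_mul_of_nonneg_left h5 (by linarith : 0 ≤ 1 - T.γ / 2)
  have h7 := mul_le_mul_of_nonneg_left (h2.trans h1) (half_pos hγ).le
  change |D n| ≤ _
  change (1 - T.γ / 2) * |D n| ≤ _ at h6
  linarith

/-- The regret of the learner, in terms of its parameters. -/
lemma regret_learner_le {c : ℝ} (hc : 0 < c) {l : ℝ} (hl0 : 0 ≤ l) (hl : 2 * l ≤ T.δ) {n : ℕ}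
    (y : Fin n → stdSimplex ℝ (Fin 8)) :
    (exoticGame c).regret T.learner y
      ≤ c / 2 * (n * (13 * T.δ) + (Real.log 2 / T.η + n * (36 * T.η / T.γ))
        + (n * (4 * Real.exp (n * (4 * l ^ 2 / T.δ) - l * (T.K - 1)))
          + T.γ / 2 * (3 / 2 * T.K + n * (4 / (T.δ * T.K))))) := by
  obtain ⟨x, rfl⟩ := exists_extension y
  rw [regret_exotic hc]
  refine mul_le_mul_of_nonneg_left ?_ (by positivity)
  have h1 := abs_sum_devL_le (T := T) (x := x) n
  have h2 := abs_sum_devR_le (T := T) (x := x) hl0 hl n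
  have h3 : ∀ t ∈ range n, meanGap c T.learner x t
      ≤ 13 * T.δ - T.runMean x t (fun s => T.base s.2 * T.slope s.1 * devL (x t)
          + (1 - T.base s.2) * |devL (x t)|)
        - T.runMean x t (fun s => (1 - T.γ / 2) * T.base s.2 * |devR (x t)|
          + (ramp T.K s.2 - ramp T.K (-s.2)) * devR (x t)) := by
    intro t _
    rw [← runMean_const (T := T) (x := x) t (13 * T.δ), ← runMean_sub, ← runMean_sub]
    exact runMean_mono (T := T) (x := x) (t := t)
      (Φ := fun s => ∑ a, T.policy s a * gap a (x t)) fun s =>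
        T.sum_policy_mul_gap_le s (coe_mem_stdSimplex _)
  have h4 := Finset.sum_le_sum h3
  rw [Finset.sum_sub_distrib, Finset.sum_sub_distrib, Finset.sum_const, card_range,
    nsmul_eq_mul] at h4
  linarith

end Tuning

/-- The minimax regret is at most of order `ρ⁻⁴ * log n`, where `n = ρ⁻⁷`. -/
lemma minimaxRegret_le {c : ℝ} (hc : 0 < c) {n : ℕ} {ρ : ℝ} (hρ0 : 0 < ρ) (hρ1 : ρ ≤ 1)
    (hn : n * ρ ^ 7 = 1) :
    (exoticGame c).minimaxRegret n ≤ c * 200 * ((1 / ρ ^ 4) * (1 + Real.log n)) := by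
  have hn0 : (0 : ℝ) < n := by
    by_contra h
    nlinarith [pow_pos hρ0 7]
  have hn1 : (1 : ℝ) ≤ n := Nat.one_le_cast.2 (Nat.cast_pos.1 hn0)
  have hlog := Real.log_nonneg hn1
  set Λ := 1 + Real.log n with hΛ
  have hΛ1 : 1 ≤ Λ := by linarith
  have hp : ∀ k, 0 < ρ ^ k := fun k => pow_pos hρ0 k
  -- `K` exceeds the scale `ρ⁻⁵` of the error of the estimate for the second square by a logarithm,
  -- so that a wrong sign is trusted with a probability of order `1 / n` only
  let T : Tuning :=
    { δ := ρ ^ 3 / 10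
      η := ρ ^ 4 / 20
      γ := ρ
      K := 20 / ρ ^ 5 * Λ
      δ_pos := by positivity
      δ_le := by linarith [pow_le_one₀ (n := 3) hρ0.le hρ1]
      η_pos := by positivity
      η_le := by linarith [pow_le_pow_of_le_one hρ0.le hρ1 (show 3 ≤ 4 by norm_num)]
      γ_pos := hρ0
      γ_le := hρ1
      K_pos := by positivity }
  have hbdd : BddBelow (Set.range fun ℓ : Learner (Fin 9) (Fin 2) =>
      ⨆ x : Fin n → stdSimplex ℝ (Fin 8), (exoticGame c).regret ℓ x) :=
    ⟨_, Set.forall_mem_range.2 fun ℓ => iSup_regret_ge hc hρ0 hρ1 hn ℓ⟩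
  have : Nonempty (stdSimplex ℝ (Fin 8)) := ⟨⟨_, single_mem_stdSimplex ℝ 0⟩⟩
  refine (ciInf_le hbdd T.learner).trans (ciSup_le fun y => ?_)
  refine (T.regret_learner_le hc (l := ρ ^ 5 / 20) (by positivity) ?_ y).trans ?_
  · change 2 * (ρ ^ 5 / 20) ≤ ρ ^ 3 / 10
    linarith [pow_le_pow_of_le_one hρ0.le hρ1 (show 3 ≤ 5 by norm_num)]
  change c / 2 * (n * (13 * (ρ ^ 3 / 10)) + (Real.log 2 / (ρ ^ 4 / 20)
      + n * (36 * (ρ ^ 4 / 20) / ρ))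
    + (n * (4 * Real.exp (n * (4 * (ρ ^ 5 / 20) ^ 2 / (ρ ^ 3 / 10))
        - ρ ^ 5 / 20 * (20 / ρ ^ 5 * Λ - 1)))
      + ρ / 2 * (3 / 2 * (20 / ρ ^ 5 * Λ) + n * (4 / (ρ ^ 3 / 10 * (20 / ρ ^ 5 * Λ)))))) ≤ _
  have hnρ : (n : ℝ) = 1 / ρ ^ 7 := by
    rw [eq_div_iff (hp 7).ne', hn]
  have t1 : n * (13 * (ρ ^ 3 / 10)) = 13 / 10 * (1 / ρ ^ 4) := by
    rw [hnρ]; field_simp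
  have t2 : Real.log 2 / (ρ ^ 4 / 20) ≤ 20 * (1 / ρ ^ 4) := by
    have : Real.log 2 ≤ 1 := by linarith [Real.log_two_lt_d9]
    rw [div_le_iff₀ (by positivity)]
    have : 20 * (1 / ρ ^ 4) * (ρ ^ 4 / 20) = 1 := by field_simp
    linarith
  have t3 : n * (36 * (ρ ^ 4 / 20) / ρ) = 36 / 20 * (1 / ρ ^ 4) := by
    rw [hnρ]; field_simp
  have t4 : n * (4 * Real.exp (n * (4 * (ρ ^ 5 / 20) ^ 2 / (ρ ^ 3 / 10))
        - ρ ^ 5 / 20 * (20 / ρ ^ 5 * Λ - 1))) ≤ 4 := by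
    have e1 : n * (4 * (ρ ^ 5 / 20) ^ 2 / (ρ ^ 3 / 10)) = 1 / 10 := by
      rw [hnρ]; field_simp; norm_num
    have e2 : ρ ^ 5 / 20 * (20 / ρ ^ 5 * Λ - 1) = Λ - ρ ^ 5 / 20 := by
      field_simp
    have e3 : Real.exp (n * (4 * (ρ ^ 5 / 20) ^ 2 / (ρ ^ 3 / 10))
        - ρ ^ 5 / 20 * (20 / ρ ^ 5 * Λ - 1)) ≤ (n : ℝ)⁻¹ := by
      rw [← Real.exp_log hn0, ← Real.exp_neg, Real.exp_log hn0, Real.exp_le_exp, e1, e2]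
      linarith [pow_le_one₀ (n := 5) hρ0.le hρ1]
    calc _ ≤ n * (4 * (n : ℝ)⁻¹) :=
          mul_le_mul_of_nonneg_left (mul_le_mul_of_nonneg_left e3 (by norm_num)) hn0.le
      _ = 4 := by field_simp
  have t5 : ρ / 2 * (3 / 2 * (20 / ρ ^ 5 * Λ)) = 15 * (1 / ρ ^ 4 * Λ) := by
    field_simp
    ring
  have t6 : ρ / 2 * (n * (4 / (ρ ^ 3 / 10 * (20 / ρ ^ 5 * Λ)))) ≤ 1 / ρ ^ 4 := by
    have : ρ / 2 * (n * (4 / (ρ ^ 3 / 10 * (20 / ρ ^ 5 * Λ)))) = 1 / ρ ^ 4 * (1 / Λ) := by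
      rw [hnρ]; field_simp; ring
    rw [this]
    exact mul_le_of_le_one_right (by positivity) ((div_le_one (by linarith)).2 hΛ1)
  have t7 : 1 ≤ 1 / ρ ^ 4 := (one_le_div (hp 4)).2 (pow_le_one₀ hρ0.le hρ1)
  have t8 : 1 / ρ ^ 4 ≤ 1 / ρ ^ 4 * Λ := le_mul_of_one_le_right (by positivity) hΛ1
  rw [mul_assoc c, div_eq_mul_one_div c 2, mul_assoc c]
  refine mul_le_mul_of_nonneg_left ?_ hc.le
  linarith

end PartialMonitoring

namespace PartialMonitoring

open Filter Topology Asymptotics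

/-! ### Growth exponents -/

lemma tendsto_log_div_log_of_bounds {R : ℕ → ℝ} {α a b : ℝ} (ha : 0 < a) (hb : 0 < b)
    (hlow : ∀ᶠ n : ℕ in atTop, a * (n : ℝ) ^ α ≤ R n)
    (hupp : ∀ᶠ n : ℕ in atTop, R n ≤ b * ((n : ℝ) ^ α * (1 + Real.log n))) :
    Tendsto (fun n : ℕ => Real.log (R n) / Real.log n) atTop (𝓝 α) := by
  have hl : Tendsto (fun n : ℕ => Real.log n) atTop atTop :=
    Real.tendsto_log_atTop.comp tendsto_natCast_atTop_atTop
  have hll : Tendsto (fun n : ℕ => Real.log (1 + Real.log n) / Real.log n) atTop (𝓝 0) := by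
    have h1 : Tendsto (fun u : ℝ => Real.log (1 + u) / u) atTop (𝓝 0) := by
      have h2 : Tendsto (fun u : ℝ => Real.log u / (1 * u + -1)) atTop (𝓝 0) := by
        simpa using Real.tendsto_pow_log_div_mul_add_atTop 1 (-1) 1 one_ne_zero
      refine (h2.comp (tendsto_atTop_add_const_left atTop 1 tendsto_id)).congr fun u => ?_
      simp
    exact h1.comp hl
  have hconst : ∀ r : ℝ, Tendsto (fun n : ℕ => r / Real.log n) atTop (𝓝 0) := fun r =>
    tendsto_const_nhds.div_atTop hl
  have h1 : Tendsto (fun n : ℕ => Real.log a / Real.log n + α) atTop (𝓝 α) := by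
    simpa using (hconst (Real.log a)).add_const α
  have h2 : Tendsto (fun n : ℕ => Real.log b / Real.log n + (α + Real.log (1 + Real.log n)
      / Real.log n)) atTop (𝓝 α) := by
    simpa using (hconst (Real.log b)).add (hll.const_add α)
  refine tendsto_of_tendsto_of_tendsto_of_le_of_le' h1 h2 ?_ ?_
  · filter_upwards [hlow, hl.eventually_gt_atTop 0, eventually_gt_atTop 0] with n hn hn' hn0
    have hn0' : (0 : ℝ) < n := Nat.cast_pos.2 hn0
    rw [le_div_iff₀ hn', add_mul, div_mul_cancel₀ _ hn'.ne', ← Real.log_rpow hn0',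
      ← Real.log_mul ha.ne' (by positivity)]
    exact Real.log_le_log (by positivity) hn
  · filter_upwards [hlow, hupp, hl.eventually_gt_atTop 0, eventually_gt_atTop 0]
      with n hm hn hn' hn0
    have hn0' : (0 : ℝ) < n := Nat.cast_pos.2 hn0
    have hR : 0 < R n := lt_of_lt_of_le (by positivity) hm
    rw [div_le_iff₀ hn', add_mul, add_mul, div_mul_cancel₀ _ hn'.ne', div_mul_cancel₀ _ hn'.ne',
      ← Real.log_rpow hn0', ← Real.log_mul (by positivity) (by positivity),
      ← Real.log_mul hb.ne' (by positivity)]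
    exact Real.log_le_log hR hn

lemma tendsto_log_div_log_of_isTheta {R : ℕ → ℝ} {β : ℝ} (hR : ∀ᶠ n in atTop, 0 < R n)
    (h : IsTheta atTop R fun n : ℕ => (n : ℝ) ^ β) :
    Tendsto (fun n : ℕ => Real.log (R n) / Real.log n) atTop (𝓝 β) := by
  obtain ⟨b, hb, hb'⟩ := h.1.exists_pos
  obtain ⟨a, ha, ha'⟩ := h.2.exists_pos
  refine tendsto_log_div_log_of_bounds (inv_pos.2 ha) hb ?_ ?_
  · filter_upwards [ha'.bound, hR] with n hn hRn
    rw [Real.norm_of_nonneg (by positivity), Real.norm_of_nonneg hRn.le] at hn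
    rwa [inv_mul_le_iff₀ ha]
  · filter_upwards [hb'.bound, hR, eventually_gt_atTop 0] with n hn hRn hn0
    rw [Real.norm_of_nonneg hRn.le, Real.norm_of_nonneg (by positivity)] at hn
    refine hn.trans (mul_le_mul_of_nonneg_left ?_ hb.le)
    have : 0 ≤ Real.log n := Real.log_natCast_nonneg n
    exact le_mul_of_one_le_right (by positivity) (by linarith)

lemma hasExoticRate_minimaxRegret {c : ℝ} (hc : 0 < c) :
    HasExoticRate (exoticGame c).minimaxRegret := by
  have hb : ∀ n : ℕ, 0 < n →
      c / 100 * (n : ℝ) ^ (4 / 7 : ℝ) ≤ (exoticGame c).minimaxRegret n ∧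
      (exoticGame c).minimaxRegret n ≤ c * 200 * ((n : ℝ) ^ (4 / 7 : ℝ) * (1 + Real.log n)) := by
    intro n hn
    have hn0 : (0 : ℝ) < n := Nat.cast_pos.2 hn
    have hn1 : (1 : ℝ) ≤ n := Nat.one_le_cast.2 hn
    set ρ : ℝ := (n : ℝ) ^ (-(1 / 7) : ℝ) with hρ
    have hρ0 : 0 < ρ := by positivity
    have hρ1 : ρ ≤ 1 := Real.rpow_le_one_of_one_le_of_nonpos hn1 (by norm_num)
    have hρ7 : n * ρ ^ 7 = 1 := by
      rw [hρ, ← Real.rpow_natCast, ← Real.rpow_mul hn0.le]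
      norm_num
      rw [Real.rpow_neg_one, mul_inv_cancel₀ hn0.ne']
    have hρ4 : 1 / ρ ^ 4 = (n : ℝ) ^ (4 / 7 : ℝ) := by
      rw [hρ, ← Real.rpow_natCast, ← Real.rpow_mul hn0.le, one_div, ← Real.rpow_neg hn0.le]
      norm_num
    rw [← hρ4]
    exact ⟨minimaxRegret_ge hc hρ0 hρ1 hρ7, minimaxRegret_le hc hρ0 hρ1 hρ7⟩
  have hpos : ∀ᶠ n in atTop, 0 < (exoticGame c).minimaxRegret n := by
    filter_upwards [eventually_gt_atTop 0] with n hn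
    have hn0 : (0 : ℝ) < n := Nat.cast_pos.2 hn
    exact lt_of_lt_of_le (by positivity) (hb n hn).1
  have hlim := tendsto_log_div_log_of_bounds (R := (exoticGame c).minimaxRegret) (α := 4 / 7)
    (a := c / 100) (b := c * 200) (by positivity) (by positivity)
    (by filter_upwards [eventually_gt_atTop 0] with n hn using (hb n hn).1)
    (by filter_upwards [eventually_gt_atTop 0] with n hn using (hb n hn).2)
  refine ⟨hpos, ?_, fun h => ?_, fun h => ?_⟩
  · exact ((continuous_coe_real_ereal.tendsto _).comp hlim).limsup_eq
  · have := tendsto_nhds_unique hlim (tendsto_log_div_log_of_isTheta hpos h)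
    norm_num at this
  · have := tendsto_nhds_unique hlim (tendsto_log_div_log_of_isTheta hpos h)
    norm_num at this

lemma exoticGame_half_loss_mem (a : Fin 9) (z : Fin 8) :
    (exoticGame (1 / 2)).loss a z ∈ Set.Icc (0 : ℝ) 1 := by
  have h : 0 ≤ exoticLoss a z ∧ exoticLoss a z ≤ 2 := by
    fin_cases a <;> fin_cases z <;> norm_num [exoticLoss]
  simp only [exoticGame, Set.mem_Icc]
  constructor <;> linarith [h.1, h.2]

end PartialMonitoring

theorem mainTheorem3 :
    -- the rescaled game is a game with losses in the unit interval
    (∀ a z, (PartialMonitoring.exoticGame (1 / 2)).loss a z ∈ Set.Icc (0 : ℝ) 1) ∧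
    -- the displayed game (`c = 1`), its rescaling to the unit interval (`c = 1 / 2`), and all others
    ∀ c : ℝ, 0 < c →
      PartialMonitoring.HasExoticRate (PartialMonitoring.exoticGame c).minimaxRegret ∧
      PartialMonitoring.HasExoticRate (PartialMonitoring.exoticGame c).minimaxSampledRegret := by
  refine ⟨PartialMonitoring.exoticGame_half_loss_mem, fun c hc => ?_⟩
  rw [PartialMonitoring.minimaxSampledRegret_eq hc]
  exact ⟨PartialMonitoring.hasExoticRate_minimaxRegret hc,
    PartialMonitoring.hasExoticRate_minimaxRegret hc⟩
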